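/- Let $E\subset\mathbb R^2$ be a convex polygon with $N$ edges (angles equal to $\pi$ allowed) and diameter $h_E$, let $\eta_E$ be the number of distinct straight lines that contain at least one edge of $E$, and let $k\ge\eta_E$. Write $\mathbb P_d$ for the polynomials of degree at most $d$ in two variables and $r_d=\dim\mathbb P_d$. Let $\{m_\alpha\}_{\alpha=1}^{r_k}$ be a basis of $\mathbb P_k$ whose first $r_{k-\eta_E}$ elements form a basis of $\mathbb P_{k-\eta_E}$ with $\|m_\alpha\|_{L_\infty(E)}\le 1$ for $\alpha\le r_{k-\eta_E}$. The degrees of freedom $\chi(v)=(\mathrm{dof}_i(v))_i$ of a function $v$ are its values at the vertices of $E$ and at the $k-1$ internal Gauss–Lobatto nodes of every edge (boundary degrees of freedom), and the moments $\frac1{|E|}\int_E v\,m_\alpha\,dx$, $1\le\alpha\le r_{k-\eta_E}$. Let $\widetilde V_k(E)$ be the space of $v\in C^0(\overline E)$ that are polynomials of degree at most $k$ on each edge and satisfy $\Delta v\in\mathbb P_k$ in $E$; let $\pi^S:\widetilde V_k(E)\to\mathbb P_k$ be given by $(\chi(\pi^Sv),\chi(m_\alpha))_{\ell_2}=(\chi(v),\chi(m_\alpha))_{\ell_2}$,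 $\alpha=1,\dots,r_k$; and let $$V^S_k(E)=\Big\{v\in\widetilde V_k(E):\ \int_E (v-\pi^Sv)\,m_\alpha\,dx=0,\ r_{k-\eta_E}<\alpha\le r_k\Big\}.$$ Let $\Pi^0_k$ be the $L_2(E)$-orthogonal projection onto $\mathbb P_k$. For a Lipschitz function $f:\mathbb R\to\mathbb R$ with constant $L_f$ and $u_h\in V^S_k(E)$, let the interpolant $I_h^kf(u_h)\in V_k^S(E)$ be the function with the same degrees of freedom as $f(u_h)$, and let the quasi-interpolant $\widetilde f_h(u_h)\in V^S_k(E)$ be the function whose boundary degrees of freedom are those of $f(u_h)$ and whose moments are $\frac1{|E|}\int_E f(\Pi^0_ku_h)\,m_\alpha\,dx$, $1\le\alpha\le r_{k-\eta_E}$. There are constants $c_1,c_2>0$ with $$c_1h_E\|\chi(v)\|_{\ell_2}\le\|v\|_{L_2(E)}\le c_2h_E\|\chi(v)\|_{\ell_2}\qquad\forall v\in V^S_k(E),$$ and for any such constants, every such $f$, every $u\in L_2(E)$ and every $u_h\in V^S_k(E)$, with $e_u=u-u_h$, $$\|I_h^kf(u_h)-\widetilde f_h(u_h)\|_{L_2(E)}\le\frac{c_2L_f\,r_{k-\eta_E}}{c_1}\Big(2\|e_u\|_{L_2(E)}+\|u-\Pi^0_ku\|_{L_2(E)}\Big).$$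 -/

import Mathlib

open MeasureTheory

noncomputable section

namespace SVEM

/-- The Euclidean plane `ℝ²`. -/
abbrev Plane : Type := EuclideanSpace ℝ (Fin 2)

/-- The function on the plane given by a polynomial in two variables. -/
def polyFun (p : MvPolynomial (Fin 2) ℝ) (x : Plane) : ℝ :=
  MvPolynomial.eval (fun j => x j) p

/-- `P_d`: polynomials of (total) degree at most `d` in two variables. -/
abbrev PolySpace (d : ℕ) : Submodule ℝ (MvPolynomial (Fin 2) ℝ) :=
  MvPolynomial.restrictTotalDegree (Fin 2) ℝ d

/-- `r_d = dim P_d`. -/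
def polyDim (d : ℕ) : ℕ := Module.finrank ℝ (PolySpace d)

/-- The norm of `L²(E)`. -/
def l2norm (E : Set Plane) (g : Plane → ℝ) : ℝ :=
  (eLpNorm g 2 (volume.restrict E)).toReal

open Classical in
/-- The `L²(E)`-orthogonal projection `Π⁰_k u` onto the polynomials of degree at most `k`:
the polynomial `p ∈ P_k` with `∫_E (p - u) q = 0` for all `q ∈ P_k`
(it exists and is unique for `u ∈ L²(E)`, `E` a bounded non-empty open set). -/
def l2Proj (E : Set Plane) (k : ℕ) (u : Plane → ℝ) : MvPolynomial (Fin 2) ℝ :=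
  if h : ∃ p ∈ PolySpace k, ∀ q ∈ PolySpace k, ∫ x in E, (polyFun p x - u x) * polyFun q x = 0
  then h.choose else 0

/-! ### Convex polygons -/

/-- The vertices `P 0, …, P (N-1)` are the vertices, in cyclic order, of a convex polygon: they are
distinct, their convex hull has interior points, its boundary is the union of the edges
`[P i, P (i+1)]` (cyclically), and different edges do not overlap.
Angles equal to `π` (split edges) are allowed. -/
structure IsConvexPolygon {N : ℕ} (P : Polygon Plane N) : Prop where
  injective : Function.Injective P.vertices
  nonempty_interior : (interior (convexHull ℝ (Set.range P.vertices))).Nonempty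
  frontier_eq : frontier (convexHull ℝ (Set.range P.vertices)) = P.boundary ℝ
  edges_disjoint : Pairwise fun i j : Fin N =>
    Disjoint (openSegment ℝ (P i) (P (finRotate N i))) (openSegment ℝ (P j) (P (finRotate N j)))

/-- The open element `E`. -/
def element {N : ℕ} (P : Polygon Plane N) : Set Plane :=
  interior (convexHull ℝ (Set.range P.vertices))

/-- `η_E`: the number of distinct straight lines containing at least one edge. -/
def eta {N : ℕ} (P : Polygon Plane N) : ℕ :=
  (Set.range fun i : Fin N => affineSpan ℝ {P i, P (finRotate N i)}).ncard

/-! ### Degrees of freedom -/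

/-- The `k - 1` internal Gauss–Lobatto nodes on `[0, 1]`: the zeros of the derivative of the
Legendre polynomial of degree `k`, transported from `[-1, 1]` to `[0, 1]`. -/
def internalGaussLobatto (k : ℕ) : Finset ℝ :=
  (Polynomial.derivative
    ((Polynomial.shiftedLegendre k).map (Int.castRingHom ℝ))).roots.toFinset

/-- The parameters of the nodes attached to one edge: its initial vertex (`0`) and its internal
Gauss–Lobatto nodes. The final vertex of the edge is the initial vertex of the next one. -/
def edgeParams (k : ℕ) : Finset ℝ := insert 0 (internalGaussLobatto k)

/-- The node `ξ` with parameter `t` on the `i`-th edge. -/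
def node {N : ℕ} (P : Polygon Plane N) (i : Fin N) (t : ℝ) : Plane := P.edgePath ℝ i t

/-- Indices of the boundary degrees of freedom (there are `k N` of them). -/
abbrev BdryIndex (N k : ℕ) : Type := Fin N × {t : ℝ // t ∈ edgeParams k}

/-- Indices of the internal-moment degrees of freedom of order `≤ k - η_E`: the first
`r_{k - η_E}` among the indices of a basis of `P_k`. -/
abbrev MomIndex {N : ℕ} (P : Polygon Plane N) (k : ℕ) : Type :=
  {α : Fin (polyDim k) // (α : ℕ) < polyDim (k - eta P)}

/-- Moment `|E|⁻¹ ∫_E g q`. -/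
def moment (E : Set Plane) (q : MvPolynomial (Fin 2) ℝ) (g : Plane → ℝ) : ℝ :=
  (volume.real E)⁻¹ * ∫ x in E, g x * polyFun q x

section

variable {N : ℕ} (P : Polygon Plane N) (k : ℕ) (m : Module.Basis (Fin (polyDim k)) ℝ (PolySpace k))

/-- The vector `χ(g)` of the degrees of freedom of `g`: the values at the boundary nodes, and the
moments against the first `r_{k - η_E}` elements of the basis `m` of `P_k`. -/
def chi (g : Plane → ℝ) : BdryIndex N k ⊕ MomIndex P k → ℝ :=
  Sum.elim (fun i => g (node P i.1 i.2)) (fun α => moment (element P) (m α) g)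

/-- The `ℓ²` norm of `χ(g)`. -/
def chiNorm (g : Plane → ℝ) : ℝ := Real.sqrt (∑ i, chi P k m g i ^ 2)

/-! ### The local spaces -/

/-- The enlarged local space: `v ∈ C⁰(closure E)`, `v` is a polynomial of degree `≤ k` on each edge
and `Δ v ∈ P_k` in `E`. A continuous function whose distributional Laplacian is a polynomial is
smooth, so that the Laplacian may be taken classically. -/
def enlargedSpace : Set (Plane → ℝ) :=
  {v | ContinuousOn v (closure (element P)) ∧
    (∀ i : Fin N, ∃ q : Polynomial ℝ, q.natDegree ≤ k ∧
      ∀ t ∈ Set.Icc (0 : ℝ) 1, v (P.edgePath ℝ i t) = q.eval t) ∧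
    ContDiffOn ℝ 2 v (element P) ∧
    ∃ p ∈ PolySpace k, ∀ x ∈ element P, Laplacian.laplacian v x = polyFun p x}

/-- `p = π^S v`, the projection onto `P_k` that is orthogonal in the degrees of freedom:
`p ∈ P_k` and `⟨χ(p), χ(m_α)⟩ = ⟨χ(v), χ(m_α)⟩` for all `α`. (On a convex polygon a polynomial in
`P_k` with vanishing degrees of freedom is zero, so that `p` is unique.) -/
def IsSerendipityProj (v : Plane → ℝ) (p : MvPolynomial (Fin 2) ℝ) : Prop :=
  p ∈ PolySpace k ∧ ∀ α : Fin (polyDim k),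
    ∑ i, chi P k m (polyFun p) i * chi P k m (polyFun (m α)) i =
      ∑ i, chi P k m v i * chi P k m (polyFun (m α)) i

/-- The local serendipity space for `k ≥ η_E`: the functions `v` of the enlarged space whose moments
against `m_α`, `r_{k - η_E} < α ≤ r_k` (counted from `1`), are those of `π^S v`. -/
def serendipitySpace : Set (Plane → ℝ) :=
  {v | v ∈ enlargedSpace P k ∧ ∃ p, IsSerendipityProj P k m v p ∧
    ∀ α : Fin (polyDim k), polyDim (k - eta P) ≤ (α : ℕ) →
      ∫ x in element P, (v x - polyFun p x) * polyFun (m α) x = 0}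

/-- `c₁, c₂` are constants of the equivalence between the `L²(E)` norm on the serendipity space and
the scaled `ℓ²` norm of the degrees of freedom: `c₁ h_E ‖χ(v)‖ ≤ ‖v‖ ≤ c₂ h_E ‖χ(v)‖`. -/
def NormEquivalence (c₁ c₂ : ℝ) : Prop :=
  0 < c₁ ∧ 0 < c₂ ∧ ∀ v ∈ serendipitySpace P k m,
    c₁ * Metric.diam (element P) * chiNorm P k m v ≤ l2norm (element P) v ∧
    l2norm (element P) v ≤ c₂ * Metric.diam (element P) * chiNorm P k m v

/-- `w` is the interpolant of `g`: the function of the serendipity space with the same degrees of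
freedom as `g`. -/
def IsInterpolant (g w : Plane → ℝ) : Prop :=
  w ∈ serendipitySpace P k m ∧ chi P k m w = chi P k m g

/-- `w` is the quasi-interpolant of `f(v)`: the function of the serendipity space whose boundary
degrees of freedom are the nodal values of `f(v)` and whose moments are those of `f(Π⁰_k v)`. -/
def IsQuasiInterpolant (f : ℝ → ℝ) (v w : Plane → ℝ) : Prop :=
  w ∈ serendipitySpace P k m ∧
    (∀ i : BdryIndex N k, chi P k m w (Sum.inl i) = f (v (node P i.1 i.2))) ∧
    ∀ α : MomIndex P k, chi P k m w (Sum.inr α) =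
      moment (element P) (m α) (fun x => f (polyFun (l2Proj (element P) k v) x))

end

end SVEM

end

/-! The error bound. The interpolant and the quasi-interpolant have the same boundary degrees of
freedom, so their difference, which lies in `V^S_k(E)`, is governed by the moments of `f(u_h) -
f(Π⁰u_h)`. By the Lipschitz bound, `|m_α| ≤ 1` and Cauchy–Schwarz, each moment is at most `L D /
√|E|` with `D = ‖u_h - Π⁰u_h‖` (`abs_moment_sub_le`). The upper norm equivalence turns this into `c₂
h r L D / √|E|`; the lower one, applied to the constant `1`, gives `c₁ h ≤ √|E|`
(`mul_diam_le_sqrt_volume`) and so removes `h` and `|E|`. Best approximation yields `D ≤ ‖u_h - Π⁰u‖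
≤ ‖e_u‖ + ‖u - Π⁰u‖`.

The constants `c₁, c₂` exist because `χ`, which has finite-dimensional range, has the same kernel on
`V^S_k(E)` as the map to `L²(E)`. The heart is unisolvence (`eqOn_zero_of_chi_eq_zero`). Let `χ(v) =
0`. Then `p = π^S v` has `χ(p) = 0`, so `p` vanishes on all edges and is the product of `η_E` affine
forms and some `q` of degree at most `k - η_E`; normalised, the forms have a product `l` that is
positive in `E`, and the moment against `q` reads `∫ l q² = 0`, whence `p = 0`. Now the remaining
moments of `v` vanish too, so `v` is orthogonal to `P_k`, in particular to `Δv`. As `v = 0` on the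
boundary, `∫ |∇v|² = -∫ v Δv = 0` and `v = 0`. This Green identity is justified by truncation, since
`∇v` is not controlled up to the boundary. -/

open MeasureTheory

noncomputable section

namespace SVEM

/-! ### Gauss–Lobatto nodes and unisolvence on one edge. -/

/-- Rolle's theorem for finitely many zeros: `j + 1` zeros of `p` in `[a, b]` give `j` zeros of `p'`
in `(a, b)`. -/
theorem exists_finset_roots_derivative (p : Polynomial ℝ) {a b : ℝ} (s : Finset ℝ) (j : ℕ)
    (hs : s.card = j + 1) (hab : ∀ x ∈ s, x ∈ Set.Icc a b) (hroot : ∀ x ∈ s, p.eval x = 0) :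
    ∃ t : Finset ℝ, t.card = j ∧ (∀ x ∈ t, x ∈ Set.Ioo a b) ∧
      ∀ x ∈ t, p.derivative.eval x = 0 := by
  let x := s.orderEmbOfFin hs
  have hx : ∀ i, x i ∈ s := fun i => s.orderEmbOfFin_mem hs i
  have hlt : ∀ i : Fin j, x i.castSucc < x i.succ := fun i =>
    x.strictMono Fin.castSucc_lt_succ
  have key : ∀ i : Fin j, ∃ y ∈ Set.Ioo (x i.castSucc) (x i.succ), p.derivative.eval y = 0 := by
    intro i
    obtain ⟨y, hy, hy'⟩ := exists_hasDerivAt_eq_zero (hlt i) p.continuous.continuousOn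
      ((hroot _ (hx _)).trans (hroot _ (hx _)).symm) (fun y _ => p.hasDerivAt y)
    exact ⟨y, hy, hy'⟩
  choose y hy hy0 using key
  have hmono : StrictMono y := by
    intro i i' h
    calc y i < x i.succ := (hy i).2
      _ ≤ x i'.castSucc := x.monotone (by
        rw [Fin.le_def]; simpa using h)
      _ < y i' := (hy i').1
  refine ⟨Finset.univ.image y, ?_, ?_, ?_⟩
  · rw [Finset.card_image_of_injective _ hmono.injective]; simp
  · intro z hz
    obtain ⟨i, -, rfl⟩ := Finset.mem_image.1 hz
    exact ⟨(hab _ (hx _)).1.trans_lt (hy i).1, (hy i).2.trans_le (hab _ (hx _)).2⟩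
  · intro z hz
    obtain ⟨i, -, rfl⟩ := Finset.mem_image.1 hz
    exact hy0 i

open Polynomial in
/-- The derivatives of order `j < n` of `Xⁿ (1 - X)ⁿ` vanish at the two end points. -/
theorem eval_iterate_derivative_X_pow_mul {n j : ℕ} (hj : j < n) {x : ℝ} (hx : x = 0 ∨ x = 1) :
    (derivative^[j] (X ^ n * (1 - X) ^ n : ℝ[X])).eval x = 0 := by
  obtain ⟨q, hq⟩ : (X - C x) ^ n ∣ (X ^ n * (1 - X) ^ n : ℝ[X]) := by
    rcases hx with rfl | rfl
    · simp
    · refine Dvd.dvd.mul_left (pow_dvd_pow_of_dvd ⟨-1, ?_⟩ n) _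
      simp
  rw [hq]
  have h2 := pow_sub_dvd_iterate_derivative_of_pow_dvd j
    (Dvd.intro q rfl : (X - C x) ^ n ∣ (X - C x) ^ n * q)
  have h3 : (X - C x) ∣ derivative^[j] ((X - C x) ^ n * q) :=
    (dvd_pow_self _ (by omega)).trans h2
  exact Polynomial.dvd_iff_isRoot.1 h3

-- Induction by Rolle: as long as `j < n`, the `j` interior zeros are joined by the end points `0`
-- and `1`, and these `j + 2` zeros give `j + 1` interior zeros of the next derivative.
open Polynomial in
theorem exists_finset_roots_iterate_derivative (n j : ℕ) (hj : j ≤ n) :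
    ∃ s : Finset ℝ, s.card = j ∧ (∀ x ∈ s, x ∈ Set.Ioo (0 : ℝ) 1) ∧
      ∀ x ∈ s, (derivative^[j] (X ^ n * (1 - X) ^ n : ℝ[X])).eval x = 0 := by
  induction j with
  | zero => exact ⟨∅, by simp⟩
  | succ j ih =>
    obtain ⟨s, hs, hs1, hs0⟩ := ih (by omega)
    have h1 : (1 : ℝ) ∉ s := fun h => by simpa using hs1 _ h
    have h0 : (0 : ℝ) ∉ insert 1 s := fun h => by
      rcases Finset.mem_insert.1 h with h | h
      · norm_num at h
      · simpa using hs1 _ h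
    obtain ⟨t, ht, ht1, ht0⟩ := exists_finset_roots_derivative
      (derivative^[j] (X ^ n * (1 - X) ^ n : ℝ[X])) (a := 0) (b := 1)
      (insert 0 (insert 1 s)) (j + 1)
      (by rw [Finset.card_insert_of_notMem h0, Finset.card_insert_of_notMem h1, hs])
      (by
        intro x hx
        simp only [Finset.mem_insert] at hx
        rcases hx with rfl | rfl | hx
        · simp
        · simp
        · exact Set.Ioo_subset_Icc_self (hs1 x hx))
      (by
        intro x hx
        simp only [Finset.mem_insert] at hx
        rcases hx with rfl | rfl | hx
        · exact eval_iterate_derivative_X_pow_mul (by omega) (Or.inl rfl)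
        · exact eval_iterate_derivative_X_pow_mul (by omega) (Or.inr rfl)
        · exact hs0 x hx)
    exact ⟨t, ht, ht1, by simpa only [Function.iterate_succ_apply'] using ht0⟩

open Polynomial in
/-- There are `k - 1` internal Gauss–Lobatto nodes, and they lie in `(0, 1)`. -/
theorem internalGaussLobatto_spec (k : ℕ) :
    (internalGaussLobatto k).card = k - 1 ∧ ∀ t ∈ internalGaussLobatto k,
      t ∈ Set.Ioo (0 : ℝ) 1 := by
  rcases Nat.eq_zero_or_pos k with rfl | hk
  -- For `k = 0` the derivative is the zero polynomial, whose `roots` are empty by convention, in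
  -- accordance with `0 - 1 = 0` in `ℕ`.
  · simp [internalGaussLobatto, shiftedLegendre]
  set q : ℝ[X] := (shiftedLegendre k).map (Int.castRingHom ℝ) with hq
  -- Rodrigues' formula gives `q` its `k` zeros in `(0, 1)`. Rolle then gives `k - 1` zeros of `q'`,
  -- and the degree leaves room for no others.
  have hrod : (k.factorial : ℝ[X]) * q = derivative^[k] (X ^ k * (1 - X) ^ k : ℝ[X]) := by
    have := congrArg (Polynomial.map (Int.castRingHom ℝ)) (factorial_mul_shiftedLegendre_eq k)
    simpa [← Polynomial.iterate_derivative_map] using this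
  have hdeg : q.natDegree = k := by
    rw [hq, natDegree_map_eq_of_injective (RingHom.injective_int _), natDegree_shiftedLegendre]
  have hdeg' : (derivative q).natDegree ≤ k - 1 := hdeg ▸ natDegree_derivative_le q
  have hne : derivative q ≠ 0 := by
    intro h
    have := derivative_eq_zero.1 h
    omega
  obtain ⟨s, hs, hs1, hs0⟩ := exists_finset_roots_iterate_derivative k k le_rfl
  obtain ⟨t, ht, ht1, ht0⟩ := exists_finset_roots_derivative q (a := 0) (b := 1) s (k - 1)
    (by omega) (fun x hx => Set.Ioo_subset_Icc_self (hs1 x hx))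
    (fun x hx => by
      have := hs0 x hx
      rw [← hrod, eval_mul, mul_eq_zero] at this
      refine this.resolve_left ?_
      simpa using k.factorial_ne_zero)
  have hsub : t ⊆ internalGaussLobatto k := by
    intro x hx
    rw [internalGaussLobatto, Multiset.mem_toFinset, mem_roots hne]
    exact ht0 x hx
  have hcard : (internalGaussLobatto k).card ≤ k - 1 :=
    (Multiset.toFinset_card_le _).trans ((card_roots' _).trans hdeg')
  have heq : t = internalGaussLobatto k := Finset.eq_of_subset_of_card_le hsub (by omega)
  exact ⟨heq ▸ ht, heq ▸ ht1⟩

theorem edgeParams_mem_Ico {k : ℕ} {t : ℝ} (ht : t ∈ edgeParams k) : t ∈ Set.Ico (0 : ℝ) 1 := by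
  rcases Finset.mem_insert.1 ht with rfl | ht
  · simp
  · exact Set.Ioo_subset_Ico_self ((internalGaussLobatto_spec k).2 t ht)

theorem card_edgeParams {k : ℕ} (hk : 1 ≤ k) : (edgeParams k).card = k := by
  rw [edgeParams, Finset.card_insert_of_notMem, (internalGaussLobatto_spec k).1]
  · omega
  · intro h
    simpa using (internalGaussLobatto_spec k).2 0 h

/-- A polynomial of degree at most `k` that vanishes at the nodes of an edge, and at the final end
point, is zero. -/
theorem eq_zero_of_eval_edgeParams {k : ℕ} (hk : 1 ≤ k) {q : Polynomial ℝ} (hq : q.natDegree ≤ k)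
    (h : ∀ t ∈ edgeParams k, q.eval t = 0) (h1 : q.eval 1 = 0) : q = 0 := by
  have hnot : (1 : ℝ) ∉ edgeParams k := fun h => by simpa using edgeParams_mem_Ico h
  refine Polynomial.eq_zero_of_natDegree_lt_card_of_eval_eq_zero' q (insert 1 (edgeParams k)) ?_ ?_
  · intro t ht
    rcases Finset.mem_insert.1 ht with rfl | ht
    exacts [h1, h t ht]
  · rw [Finset.card_insert_of_notMem hnot, card_edgeParams hk]
    omega

/-! ### Polynomials on lines -/

theorem polyFun_add (p q : MvPolynomial (Fin 2) ℝ) (x : Plane) :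
    polyFun (p + q) x = polyFun p x + polyFun q x := by simp [polyFun]

theorem polyFun_mul (p q : MvPolynomial (Fin 2) ℝ) (x : Plane) :
    polyFun (p * q) x = polyFun p x * polyFun q x := by simp [polyFun]

theorem polyFun_smul (c : ℝ) (p : MvPolynomial (Fin 2) ℝ) (x : Plane) :
    polyFun (c • p) x = c * polyFun p x := by simp [polyFun]

theorem polyFun_sub (p q : MvPolynomial (Fin 2) ℝ) (x : Plane) :
    polyFun (p - q) x = polyFun p x - polyFun q x := by simp [polyFun]

theorem polyFun_prod {ι : Type*} (s : Finset ι) (p : ι → MvPolynomial (Fin 2) ℝ) (x : Plane) :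
    polyFun (∏ i ∈ s, p i) x = ∏ i ∈ s, polyFun (p i) x := by simp [polyFun]

theorem continuous_polyFun (p : MvPolynomial (Fin 2) ℝ) : Continuous (polyFun p) := by
  unfold polyFun
  exact (MvPolynomial.continuous_eval p).comp
    (by fun_prop : Continuous fun x : Plane => fun j => x j)

theorem mem_polySpace {d : ℕ} {p : MvPolynomial (Fin 2) ℝ} :
    p ∈ PolySpace d ↔ p.totalDegree ≤ d :=
  MvPolynomial.mem_restrictTotalDegree _ _ _

theorem polySpace_mono {d e : ℕ} (h : d ≤ e) : PolySpace d ≤ PolySpace e := fun _ hp =>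
  mem_polySpace.2 ((mem_polySpace.1 hp).trans h)

/-- A polynomial that vanishes on a nonempty open set is zero. -/
theorem eq_zero_of_polyFun_eqOn_zero {p : MvPolynomial (Fin 2) ℝ} {U : Set Plane} (hU : IsOpen U)
    (hne : U.Nonempty) (h : ∀ x ∈ U, polyFun p x = 0) : p = 0 := by
  obtain ⟨a, ha⟩ := hne
  let e := EuclideanSpace.equiv (Fin 2) ℝ
  have hopen : IsOpen (e.symm ⁻¹' U) := hU.preimage e.symm.continuous
  obtain ⟨ε, hε, hball⟩ := Metric.isOpen_iff.1 hopen (e a) (by simpa using ha)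
  -- A ball of the sup norm is a product of intervals, hence of infinite sets.
  refine MvPolynomial.funext_set (fun i => Metric.ball (e a i) ε) (fun i => ?_) fun x hx => ?_
  · rw [Real.ball_eq_Ioo]
    exact Set.Ioo_infinite (by linarith)
  · have hx' : x ∈ Metric.ball (e a) ε := by
      rw [ball_pi _ hε]
      exact hx
    simpa [polyFun, e] using h _ (hball hx')

/-- The restriction of a polynomial to the line `t ↦ A + t d`. -/
def lineRestrict (A d : Plane) : MvPolynomial (Fin 2) ℝ →ₐ[ℝ] Polynomial ℝ :=
  MvPolynomial.aeval fun j => Polynomial.C (A j) + Polynomial.C (d j) * Polynomial.X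

theorem eval_lineRestrict (A d : Plane) (p : MvPolynomial (Fin 2) ℝ) (t : ℝ) :
    (lineRestrict A d p).eval t = polyFun p (A + t • d) := by
  have : (Polynomial.aeval t).comp (lineRestrict A d) =
      MvPolynomial.aeval (R := ℝ) (fun j => (A + t • d) j) := by
    apply MvPolynomial.algHom_ext
    intro i
    simp only [lineRestrict, AlgHom.comp_apply, MvPolynomial.aeval_X, map_add, map_mul,
      Polynomial.aeval_C,
      Polynomial.aeval_X]
    simp [mul_comm]
  have h := DFunLike.congr_fun this p
  simpa [polyFun, Polynomial.aeval_def, MvPolynomial.aeval_eq_eval, Polynomial.eval₂_eq_eval_map]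
    using h

theorem natDegree_lineRestrict_le (A d : Plane) {p : MvPolynomial (Fin 2) ℝ} {k : ℕ}
    (hp : p ∈ PolySpace k) : (lineRestrict A d p).natDegree ≤ k := by
  have := MvPolynomial.aeval_natDegree_le p (mem_polySpace.1 hp)
    (fun j => Polynomial.C (A j) + Polynomial.C (d j) * Polynomial.X) (n := 1)
    (fun i => by compute_degree)
  simpa [lineRestrict] using this

/-- An affine form that vanishes on the line `t ↦ A + t d`. -/
def lineForm (A d : Plane) : MvPolynomial (Fin 2) ℝ :=
  MvPolynomial.C (d 0) * (MvPolynomial.X 1 - MvPolynomial.C (A 1)) -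
    MvPolynomial.C (d 1) * (MvPolynomial.X 0 - MvPolynomial.C (A 0))

theorem polyFun_lineForm (A d x : Plane) :
    polyFun (lineForm A d) x = d 0 * (x 1 - A 1) - d 1 * (x 0 - A 0) := by
  simp [polyFun, lineForm]

theorem sq_add_sq_pos {d : Plane} (hd : d ≠ 0) : 0 < d 0 ^ 2 + d 1 ^ 2 := by
  by_contra! h
  have h0 : d 0 = 0 := by nlinarith [sq_nonneg (d 0), sq_nonneg (d 1)]
  have h1 : d 1 = 0 := by nlinarith [sq_nonneg (d 0), sq_nonneg (d 1)]
  apply hd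
  ext i
  fin_cases i <;> simpa

/-- The zeros of the affine form of a line are the points of the line. -/
theorem exists_eq_of_polyFun_lineForm_eq_zero {A d x : Plane} (hd : d ≠ 0)
    (h : polyFun (lineForm A d) x = 0) : ∃ t : ℝ, x = A + t • d := by
  have hpos := sq_add_sq_pos hd
  rw [polyFun_lineForm] at h
  -- The parameter of the orthogonal projection of `x` onto the line.
  refine ⟨(d 0 * (x 0 - A 0) + d 1 * (x 1 - A 1)) / (d 0 ^ 2 + d 1 ^ 2), ?_⟩
  ext i
  fin_cases i
  · simp
    field_simp
    linear_combination (- d 1) * h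
  · simp
    field_simp
    linear_combination (d 0) * h

/-- The form takes the value `0` at `A` and `|d|²` at `A` shifted by the rotated direction, so it is
not constant. -/
theorem one_le_totalDegree_lineForm (A : Plane) {d : Plane} (hd : d ≠ 0) :
    1 ≤ (lineForm A d).totalDegree := by
  rw [Nat.one_le_iff_ne_zero]
  intro h
  have hC := MvPolynomial.totalDegree_eq_zero_iff_eq_C.1 h
  set c := MvPolynomial.coeff 0 (lineForm A d)
  have h1 : ∀ x, polyFun (lineForm A d) x = c := fun x => by rw [hC]; simp [polyFun]
  have h2 := h1 A
  have h3 := h1 (A + WithLp.toLp 2 ![-d 1, d 0])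
  rw [polyFun_lineForm] at h2 h3
  have := sq_add_sq_pos hd
  simp at h2 h3
  nlinarith

/-- A polynomial that vanishes on a line is divisible by the affine form of the line. -/
theorem lineForm_dvd {A d : Plane} (hd : d ≠ 0) {p : MvPolynomial (Fin 2) ℝ}
    (h : lineRestrict A d p = 0) : lineForm A d ∣ p := by
  have hpos := (sq_add_sq_pos hd).ne'
  set s := d 0 ^ 2 + d 1 ^ 2 with hs
  -- `τ` is the line parameter as a polynomial on the plane. Modulo the affine form, `X_i = A_i +
  -- d_i τ`, so `p` is congruent to its restriction to the line evaluated at `τ`, which is zero.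
  let τ : MvPolynomial (Fin 2) ℝ := MvPolynomial.C s⁻¹ *
    (MvPolynomial.C (d 0) * (MvPolynomial.X 0 - MvPolynomial.C (A 0)) +
      MvPolynomial.C (d 1) * (MvPolynomial.X 1 - MvPolynomial.C (A 1)))
  let I : Ideal (MvPolynomial (Fin 2) ℝ) := Ideal.span {lineForm A d}
  have hcomp : (Ideal.Quotient.mkₐ ℝ I).comp
      ((Polynomial.aeval (R := ℝ) τ).comp (lineRestrict A d)) = Ideal.Quotient.mkₐ ℝ I := by
    apply MvPolynomial.algHom_ext
    intro i
    simp only [AlgHom.comp_apply, Ideal.Quotient.mkₐ_eq_mk, lineRestrict, MvPolynomial.aeval_X,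
      map_add, map_mul, Polynomial.aeval_C, Polynomial.aeval_X]
    rw [← map_mul, ← map_add, Ideal.Quotient.eq, Ideal.mem_span_singleton]
    have hCs : (MvPolynomial.C s⁻¹ * MvPolynomial.C s : MvPolynomial (Fin 2) ℝ) = 1 := by
      rw [← map_mul, inv_mul_cancel₀ hpos, map_one]
    have hCs' : (MvPolynomial.C s : MvPolynomial (Fin 2) ℝ) =
        MvPolynomial.C (d 0) ^ 2 + MvPolynomial.C (d 1) ^ 2 := by simp [hs]
    rw [hCs'] at hCs
    fin_cases i
    · refine ⟨MvPolynomial.C s⁻¹ * MvPolynomial.C (d 1), ?_⟩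
      simp only [lineForm, τ, MvPolynomial.algebraMap_eq]
      simp
      linear_combination (MvPolynomial.X 0 - MvPolynomial.C (A 0)) * hCs
    · refine ⟨-MvPolynomial.C s⁻¹ * MvPolynomial.C (d 0), ?_⟩
      simp only [lineForm, τ, MvPolynomial.algebraMap_eq]
      simp
      linear_combination (MvPolynomial.X 1 - MvPolynomial.C (A 1)) * hCs
  have hp := DFunLike.congr_fun hcomp p
  simp only [AlgHom.comp_apply, h, map_zero, Ideal.Quotient.mkₐ_eq_mk] at hp
  rw [eq_comm, Ideal.Quotient.eq_zero_iff_mem, Ideal.mem_span_singleton] at hp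
  exact hp

/-- A polynomial that vanishes on finitely many distinct lines is divisible by the product of their
affine forms. -/
theorem prod_lineForm_dvd {ι : Type*} (A d : ι → Plane) (hd : ∀ i, d i ≠ 0) (S : Finset ι)
    (hdist : ∀ i ∈ S, ∀ j ∈ S, lineRestrict (A i) (d i) (lineForm (A j) (d j)) = 0 → i = j)
    {p : MvPolynomial (Fin 2) ℝ} (hp : ∀ i ∈ S, lineRestrict (A i) (d i) p = 0) :
    ∏ i ∈ S, lineForm (A i) (d i) ∣ p := by
  classical
  induction S using Finset.induction_on with
  | empty => simp
  | insert i S hi ih =>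
    obtain ⟨q, rfl⟩ := ih
      (fun a ha b hb => hdist a (Finset.mem_insert_of_mem ha) b (Finset.mem_insert_of_mem hb))
      (fun a ha => hp a (Finset.mem_insert_of_mem ha))
    have h := hp i (Finset.mem_insert_self _ _)
    rw [map_mul, map_prod, mul_eq_zero, Finset.prod_eq_zero_iff] at h
    have hq : lineRestrict (A i) (d i) q = 0 := by
      refine h.resolve_left ?_
      rintro ⟨j, hj, hj0⟩
      have := hdist i (Finset.mem_insert_self _ _) j (Finset.mem_insert_of_mem hj) hj0
      exact hi (this ▸ hj)
    obtain ⟨r, rfl⟩ := lineForm_dvd (hd i) hq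
    rw [Finset.prod_insert hi]
    exact ⟨r, by ring⟩

/-! ### Geometry of the element -/

section

variable {N : ℕ} {P : Polygon Plane N}

theorem isOpen_element : IsOpen (element P) := isOpen_interior

theorem convex_element : Convex ℝ (element P) := (convex_convexHull ℝ _).interior

theorem isCompact_hull : IsCompact (convexHull ℝ (Set.range P.vertices)) :=
  (Set.finite_range _).isCompact_convexHull ℝ

theorem isBounded_element : Bornology.IsBounded (element P) :=
  (isCompact_hull (P := P)).isBounded.subset interior_subset

theorem volume_element_ne_top : volume (element P) ≠ ⊤ :=
  (isBounded_element (P := P)).measure_lt_top.ne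

theorem isCompact_closure_element : IsCompact (closure (element P)) :=
  (isBounded_element (P := P)).isCompact_closure

theorem edgePath_eq (P : Polygon Plane N) (i : Fin N) (t : ℝ) :
    P.edgePath ℝ i t = P i + t • (P (finRotate N i) - P i) := by
  rw [Polygon.edgePath, AffineMap.lineMap_apply]
  simp [add_comm]

namespace IsConvexPolygon

theorem element_nonempty (hP : IsConvexPolygon P) : (element P).Nonempty := hP.nonempty_interior

theorem volume_element_pos (hP : IsConvexPolygon P) : 0 < volume.real (element P) :=
  ENNReal.toReal_pos (isOpen_element.measure_pos _ hP.element_nonempty).ne' volume_element_ne_top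

theorem diam_element_pos (hP : IsConvexPolygon P) : 0 < Metric.diam (element P) := by
  refine (ENNReal.toReal_pos ?_ isBounded_element.ediam_ne_top)
  rw [← pos_iff_ne_zero, Metric.ediam_pos_iff]
  refine Set.not_subsingleton_iff.1 fun h => ?_
  have h2 := hP.element_nonempty
  rcases h.eq_empty_or_singleton with h0 | ⟨x, h0⟩
  · simp [h0] at h2
  · have h3 := isOpen_element (P := P)
    rw [h0] at h3
    exact not_isOpen_singleton x h3

theorem closure_element (hP : IsConvexPolygon P) :
    closure (element P) = convexHull ℝ (Set.range P.vertices) := by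
  rw [element, (convex_convexHull ℝ _).closure_interior_eq_closure_of_nonempty_interior
    hP.nonempty_interior, isCompact_hull.isClosed.closure_eq]

theorem frontier_element (hP : IsConvexPolygon P) : frontier (element P) = P.boundary ℝ := by
  rw [← hP.frontier_eq, frontier, hP.closure_element, isOpen_element.interior_eq, frontier,
    isCompact_hull.isClosed.closure_eq, element]

theorem mem_frontier_iff (hP : IsConvexPolygon P) {x : Plane} :
    x ∈ frontier (element P) ↔ ∃ i, ∃ t ∈ Set.Icc (0 : ℝ) 1, P.edgePath ℝ i t = x := by
  simp [hP.frontier_element, Polygon.boundary, Polygon.edgeSet_eq_image_edgePath]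

theorem edgePath_mem_frontier (hP : IsConvexPolygon P) (i : Fin N)
    {t : ℝ} (ht : t ∈ Set.Icc (0 : ℝ) 1) :
    P.edgePath ℝ i t ∈ frontier (element P) := hP.mem_frontier_iff.2 ⟨i, t, ht, rfl⟩

theorem edgePath_mem_closure (hP : IsConvexPolygon P) (i : Fin N)
    {t : ℝ} (ht : t ∈ Set.Icc (0 : ℝ) 1) :
    P.edgePath ℝ i t ∈ closure (element P) :=
  frontier_subset_closure (hP.edgePath_mem_frontier i ht)

theorem node_mem_closure (hP : IsConvexPolygon P) {k : ℕ} (i : BdryIndex N k) :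
    node P i.1 i.2 ∈ closure (element P) :=
  hP.edgePath_mem_closure _ (Set.Ico_subset_Icc_self (edgeParams_mem_Ico i.2.2))

theorem two_le (hP : IsConvexPolygon P) : 2 ≤ N := by
  by_contra! h
  have hsub : (Set.range P.vertices).Subsingleton := by
    interval_cases N
    · rintro _ ⟨i, _⟩
      exact i.elim0
    · rintro _ ⟨i, rfl⟩ _ ⟨j, rfl⟩
      rw [Subsingleton.elim i j]
  have h2 := hP.nonempty_interior
  rcases hsub.eq_empty_or_singleton with h0 | ⟨x, h0⟩ <;> rw [h0] at h2 <;> simp at h2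

theorem edge_ne (hP : IsConvexPolygon P) (i : Fin N) : P (finRotate N i) - P i ≠ 0 := by
  rw [sub_ne_zero]
  intro h
  have hi : finRotate N i = i := hP.injective h
  have h2 := hP.two_le
  obtain ⟨n, rfl⟩ : ∃ n, N = n + 2 := ⟨N - 2, by omega⟩
  rw [finRotate_apply] at hi
  simp at hi

theorem one_le_eta (hP : IsConvexPolygon P) : 1 ≤ eta P := by
  have := hP.two_le
  have : Nonempty (Fin N) := ⟨⟨0, by omega⟩⟩
  exact (Set.ncard_pos (Set.finite_range _)).2 (Set.range_nonempty _)

/-- The element lies strictly on one side of the line through each edge. -/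
theorem exists_mul_lineForm_pos (hP : IsConvexPolygon P) (i : Fin N) : ∃ c : ℝ, ∀ x ∈ element P,
    0 < c * polyFun (lineForm (P i) (P (finRotate N i) - P i)) x := by
  set d := P (finRotate N i) - P i with hd
  have hmid := hP.edgePath_mem_frontier i (t := 1 / 2) (by norm_num)
  have hnot : P.edgePath ℝ i (1 / 2) ∉ element P := by
    rw [frontier, isOpen_element.interior_eq] at hmid
    exact hmid.2
  obtain ⟨g, hg⟩ := geometric_hahn_banach_open_point convex_element isOpen_element hnot
  -- On the edge the separating functional attains its maximum at the midpoint, so it is constant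
  -- along the edge.
  have hle : ∀ t ∈ Set.Icc (0 : ℝ) 1, g (P i) + t * g d ≤ g (P i) + 1 / 2 * g d := by
    intro t ht
    have hcl : closure (element P) ⊆ {x | g x ≤ g (P.edgePath ℝ i (1 / 2))} :=
      closure_minimal (fun x hx => (hg x hx).le) (isClosed_le g.continuous continuous_const)
    have := hcl (hP.edgePath_mem_closure i ht)
    simpa only [Set.mem_ofPred_eq, edgePath_eq, map_add, map_smul, smul_eq_mul] using this
  have hgd : g d = 0 := by
    have h0 := hle 0 (by simp)
    have h1 := hle 1 (by simp)
    linarith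
  have hgx : ∀ x : Plane, g x = x 0 * g (EuclideanSpace.single 0 1) +
      x 1 * g (EuclideanSpace.single 1 1) := by
    intro x
    have : x = x 0 • EuclideanSpace.single 0 (1 : ℝ) + x 1 • EuclideanSpace.single 1 (1 : ℝ) := by
      ext j
      fin_cases j <;> simp
    conv_lhs => rw [this]
    simp
  set a := g (EuclideanSpace.single 0 1)
  set b := g (EuclideanSpace.single 1 1)
  have hpos := sq_add_sq_pos (hP.edge_ne i)
  rw [← hd] at hpos
  -- With this constant the scaled form is exactly `g (P i) - g x`.
  refine ⟨(a * d 1 - b * d 0) / (d 0 ^ 2 + d 1 ^ 2), fun x hx => ?_⟩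
  have h1 := hg x hx
  rw [edgePath_eq, map_add, map_smul, ← hd, hgd, smul_zero, add_zero, hgx, hgx (P i)] at h1
  rw [hgx] at hgd
  rw [polyFun_lineForm, div_mul_eq_mul_div]
  refine div_pos ?_ hpos
  have : (a * d 1 - b * d 0) * (d 0 * (x 1 - P i 1) - d 1 * (x 0 - P i 0)) =
      (d 0 ^ 2 + d 1 ^ 2) * ((P i 0 * a + P i 1 * b) - (x 0 * a + x 1 * b)) := by
    linear_combination (d 0 * (x 0 - P i 0) + d 1 * (x 1 - P i 1)) * hgd
  rw [this]
  exact mul_pos hpos (by linarith)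

/-- Edges on different lines: the form of the one does not vanish on the other. -/
theorem line_eq_of_lineRestrict_eq_zero (hP : IsConvexPolygon P) {i j : Fin N}
    (h : lineRestrict (P i) (P (finRotate N i) - P i)
      (lineForm (P j) (P (finRotate N j) - P j)) = 0) :
    affineSpan ℝ {P i, P (finRotate N i)} = affineSpan ℝ {P j, P (finRotate N j)} := by
  have hmem : ∀ t : ℝ, P i + t • (P (finRotate N i) - P i) ∈
      affineSpan ℝ {P j, P (finRotate N j)} := by
    intro t
    obtain ⟨s, hs⟩ := exists_eq_of_polyFun_lineForm_eq_zero (hP.edge_ne j)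
      (x := P i + t • (P (finRotate N i) - P i)) (by rw [← eval_lineRestrict, h]; simp)
    rw [hs, ← edgePath_eq]
    exact AffineMap.lineMap_mem_affineSpan_pair _ _ _
  refine affineSpan_pair_eq_of_mem_of_mem_of_ne (by simpa using hmem 0) (by simpa using hmem 1) ?_
  exact (sub_ne_zero.1 (hP.edge_ne i)).symm

/-- A polynomial of degree at most `k` that vanishes at the boundary nodes is the product of a
polynomial that is positive in the element and one of degree at most `k - η_E`. -/
theorem exists_eq_mul_of_node_eq_zero (hP : IsConvexPolygon P) {k : ℕ} (hk : eta P ≤ k)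
    {p : MvPolynomial (Fin 2) ℝ}
    (hp : p ∈ PolySpace k) (h : ∀ i : BdryIndex N k, polyFun p (node P i.1 i.2) = 0) :
    ∃ l q, p = l * q ∧ q ∈ PolySpace (k - eta P) ∧ ∀ x ∈ element P, 0 < polyFun l x := by
  classical
  have hk1 : 1 ≤ k := hP.one_le_eta.trans hk
  by_cases hp0 : p = 0
  · exact ⟨1, 0, by simp [hp0], by simp, by simp [polyFun]⟩
  let A : Fin N → Plane := fun i => P i
  let d : Fin N → Plane := fun i => P (finRotate N i) - P i
  have hd : ∀ i, d i ≠ 0 := hP.edge_ne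
  have hzero : ∀ i, lineRestrict (A i) (d i) p = 0 := by
    intro i
    refine eq_zero_of_eval_edgeParams hk1 (natDegree_lineRestrict_le _ _ hp) (fun t ht => ?_) ?_
    · rw [eval_lineRestrict, ← edgePath_eq]
      exact h (i, ⟨t, ht⟩)
    -- The final end point of an edge is the node with parameter `0` of the next edge.
    · have := h (finRotate N i, ⟨0, Finset.mem_insert_self _ _⟩)
      rw [eval_lineRestrict]
      simpa [node, edgePath_eq, A, d] using this
  let line : Fin N → AffineSubspace ℝ Plane := fun i => affineSpan ℝ {P i, P (finRotate N i)}
  -- One representative edge for each line: collinear edges share a form, which may be divided out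
  -- only once.
  obtain ⟨S, hSinj, hScard⟩ : ∃ S : Finset (Fin N), Set.InjOn line S ∧ S.card = eta P := by
    obtain ⟨S, hS, himg⟩ := Set.SurjOn.exists_bijOn_subset (f := line) (s := Set.univ)
      (t := Set.range line) (by intro x hx; simpa using hx)
    refine ⟨(Set.toFinite S).toFinset, by simpa using himg.injOn, ?_⟩
    rw [eta, ← Set.ncard_eq_toFinset_card S (Set.toFinite S)]
    change S.ncard = (Set.range line).ncard
    rw [← himg.image_eq, himg.injOn.ncard_image]
  obtain ⟨q, hq⟩ := prod_lineForm_dvd A d hd S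
    (fun i hi j hj hij => hSinj hi hj (hP.line_eq_of_lineRestrict_eq_zero hij))
    (fun i _ => hzero i)
  choose c hc using hP.exists_mul_lineForm_pos
  have hc0 : ∀ i, c i ≠ 0 := by
    intro i hi
    obtain ⟨x, hx⟩ := hP.element_nonempty
    simpa [hi] using hc i x hx
  have hprod : (∏ i ∈ S, c i) ≠ 0 := Finset.prod_ne_zero_iff.2 fun i _ => hc0 i
  refine ⟨(∏ i ∈ S, c i) • ∏ i ∈ S, lineForm (A i) (d i), (∏ i ∈ S, c i)⁻¹ • q, ?_, ?_, ?_⟩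
  · rw [smul_mul_smul_comm, mul_inv_cancel₀ hprod, one_smul, hq]
  · refine Submodule.smul_mem _ _ (mem_polySpace.2 ?_)
    have hne : (∏ i ∈ S, lineForm (A i) (d i)) ≠ 0 ∧ q ≠ 0 := by
      rw [hq] at hp0
      exact ⟨left_ne_zero_of_mul hp0, right_ne_zero_of_mul hp0⟩
    have hdeg : S.card ≤ (∏ i ∈ S, lineForm (A i) (d i)).totalDegree := by
      have key : ∀ T ⊆ S, T.card ≤ (∏ i ∈ T, lineForm (A i) (d i)).totalDegree := by
        intro T hT
        induction T using Finset.induction_on with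
        | empty => simp
        | insert i T hi ih =>
          have hne' := fun j (hj : j ∈ insert i T) => Finset.prod_ne_zero_iff.1 hne.1 j (hT hj)
          rw [Finset.prod_insert hi, Finset.card_insert_of_notMem hi,
            MvPolynomial.totalDegree_mul_of_isDomain (hne' i (Finset.mem_insert_self _ _))
            (Finset.prod_ne_zero_iff.2 fun j hj => hne' j (Finset.mem_insert_of_mem hj))]
          have h1 := one_le_totalDegree_lineForm (A i) (hd i)
          have h2 := ih fun j hj => hT (Finset.mem_insert_of_mem hj)
          omega
      exact key S subset_rfl
    have hp' := mem_polySpace.1 hp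
    rw [hq, MvPolynomial.totalDegree_mul_of_isDomain hne.1 hne.2] at hp'
    omega
  · intro x hx
    rw [polyFun_smul, polyFun_prod, ← Finset.prod_mul_distrib]
    exact Finset.prod_pos fun i _ => hc i x hx

end IsConvexPolygon
end

/-! ### Uniqueness for a Dirichlet problem -/

/-- A continuous cut-off: `0` on `[-ε, ε]`, `1` outside `[-2ε, 2ε]`. -/
def softThresholdDeriv (ε t : ℝ) : ℝ := max 0 (min 1 (|t| / ε - 1))

theorem continuous_softThresholdDeriv (ε : ℝ) : Continuous (softThresholdDeriv ε) := by
  unfold softThresholdDeriv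
  fun_prop

theorem softThresholdDeriv_nonneg (ε t : ℝ) : 0 ≤ softThresholdDeriv ε t := le_max_left _ _

theorem softThresholdDeriv_le_one (ε t : ℝ) : softThresholdDeriv ε t ≤ 1 :=
  max_le zero_le_one (min_le_left _ _)

theorem softThresholdDeriv_eq_zero {ε t : ℝ} (hε : 0 < ε) (h : |t| ≤ ε) :
    softThresholdDeriv ε t = 0 := by
  have : |t| / ε ≤ 1 := (div_le_one hε).2 h
  exact max_eq_left ((min_le_right _ _).trans (by linarith))

theorem softThresholdDeriv_eq_one {ε t : ℝ} (hε : 0 < ε) (h : 2 * ε ≤ |t|) :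
    softThresholdDeriv ε t = 1 := by
  have : 2 ≤ |t| / ε := (le_div_iff₀ hε).2 h
  rw [softThresholdDeriv, min_eq_left (by linarith), max_eq_right zero_le_one]

/-- This monotonicity lets bounds at arbitrarily small thresholds control the integral at a fixed
one. -/
theorem softThresholdDeriv_anti {ε δ : ℝ} (hδ : 0 < δ) (h : δ ≤ ε) (t : ℝ) :
    softThresholdDeriv ε t ≤ softThresholdDeriv δ t := by
  unfold softThresholdDeriv
  gcongr

/-- A `C¹` nondecreasing function that vanishes on `[-ε, ε]` and differs from the identity by at
most `2ε`. -/
def softThreshold (ε s : ℝ) : ℝ := ∫ t in (0 : ℝ)..s, softThresholdDeriv ε t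

theorem hasDerivAt_softThreshold (ε s : ℝ) :
    HasDerivAt (softThreshold ε) (softThresholdDeriv ε s) s :=
  intervalIntegral.integral_hasDerivAt_right
    ((continuous_softThresholdDeriv ε).intervalIntegrable _ _)
    ((continuous_softThresholdDeriv ε).stronglyMeasurableAtFilter _ _)
    (continuous_softThresholdDeriv ε).continuousAt

theorem continuous_softThreshold (ε : ℝ) : Continuous (softThreshold ε) :=
  continuous_iff_continuousAt.2 fun s => (hasDerivAt_softThreshold ε s).continuousAt

theorem softThreshold_eq_zero {ε s : ℝ} (hε : 0 < ε) (h : |s| ≤ ε) : softThreshold ε s = 0 := by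
  rw [softThreshold, intervalIntegral.integral_congr (g := fun _ => 0),
    intervalIntegral.integral_zero]
  intro t ht
  refine softThresholdDeriv_eq_zero hε ?_
  have := Set.abs_sub_left_of_mem_uIcc ht
  simp only [sub_zero] at this
  exact this.trans h

/-- The integrand `softThresholdDeriv ε t - 1` has modulus at most `1` and vanishes for `|t| ≥ 2ε`,
so only the integral from `0` to `s` clamped to `[-2ε, 2ε]` remains. -/
theorem abs_softThreshold_sub_le {ε : ℝ} (hε : 0 < ε) (s : ℝ) :
    |softThreshold ε s - s| ≤ 2 * ε := by
  have hc : Continuous fun t => softThresholdDeriv ε t - 1 :=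
    (continuous_softThresholdDeriv ε).sub continuous_const
  have h1 : softThreshold ε s - s = ∫ t in (0 : ℝ)..s, (softThresholdDeriv ε t - 1) := by
    rw [intervalIntegral.integral_sub ((continuous_softThresholdDeriv ε).intervalIntegrable _ _)
      (by simp)]
    simp [softThreshold]
  set c := max (-(2 * ε)) (min s (2 * ε)) with hcdef
  have hcabs : |c| ≤ 2 * ε := abs_le.2 ⟨le_max_left _ _, max_le (by linarith) (min_le_right _ _)⟩
  have h2 : ∫ t in c..s, (softThresholdDeriv ε t - 1) = 0 := by
    rw [← norm_le_zero_iff]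
    refine (intervalIntegral.norm_integral_le_of_norm_le_const (C := 0) fun t ht => ?_).trans
      (by simp)
    rw [softThresholdDeriv_eq_one hε, sub_self, norm_zero]
    rcases Set.mem_uIoc.1 ht with ⟨h3, h4⟩ | ⟨h3, h4⟩
    · rw [le_abs]
      left
      have : min s (2 * ε) < t := (le_max_right _ _).trans_lt h3
      rcases min_lt_iff.1 this with h | h <;> linarith
    · rw [le_abs]
      right
      rcases le_max_iff.1 h4 with h | h
      · linarith
      · have := min_le_left s (2 * ε)
        linarith
  rw [h1, ← intervalIntegral.integral_add_adjacent_intervals (hc.intervalIntegrable 0 c)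
    (hc.intervalIntegrable c s), h2, add_zero,
    ← Real.norm_eq_abs]
  refine (intervalIntegral.norm_integral_le_of_norm_le_const (C := 1) fun t _ => ?_).trans ?_
  · rw [Real.norm_eq_abs, abs_le]
    have := softThresholdDeriv_nonneg ε t
    have := softThresholdDeriv_le_one ε t
    constructor <;> linarith
  · simpa using hcabs

/-- A function that is continuous in an open set `U` and vanishes outside of a compact subset of `U`
is integrable. -/
theorem integrable_of_continuousOn_of_eq_zero {U K : Set Plane} {H : Plane → ℝ}
    (hK : IsCompact K) (hKU : K ⊆ U) (hH : ContinuousOn H U) (h0 : ∀ x ∉ K, H x = 0) :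
    Integrable H := by
  rw [← integrableOn_iff_integrable_of_support_subset (s := K)]
  · exact (hH.mono hKU).integrableOn_compact hK
  · intro x hx
    by_contra h
    exact hx (h0 x h)

section

variable {U : Set Plane} {v : Plane → ℝ}

theorem contDiffOn_fderiv_of_contDiffOn (hU : IsOpen U) (hv2 : ContDiffOn ℝ 2 v U) :
    ContDiffOn ℝ 1 (fderiv ℝ v) U :=
  hv2.fderiv_of_isOpen hU (by norm_num)

/-- Integration by parts against a truncation of `v` that vanishes near the boundary. -/
theorem integral_softThreshold_mul_eq (hU : IsOpen U) (hUb : Bornology.IsBounded U)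
    (hv : ContinuousOn v (closure U)) (hv2 : ContDiffOn ℝ 2 v U) (hv0 : ∀ x ∈ frontier U, v x = 0)
    {ε : ℝ} (hε : 0 < ε) (e : Plane) :
    Integrable (fun x => softThresholdDeriv ε (U.indicator v x) * fderiv ℝ v x e ^ 2) ∧
    Integrable (fun x => softThreshold ε (U.indicator v x) * iteratedFDeriv ℝ 2 v x ![e, e]) ∧
    ∫ x, softThreshold ε (U.indicator v x) * iteratedFDeriv ℝ 2 v x ![e, e] =
      - ∫ x, softThresholdDeriv ε (U.indicator v x) * fderiv ℝ v x e ^ 2 := by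
  set w := U.indicator v with hw
  have hwc : Continuous w := continuous_indicator hv0 hv
  have hwU : ∀ x ∈ U, w x = v x := fun x hx => Set.indicator_of_mem hx v
  have hwU' : ∀ x ∉ U, w x = 0 := fun x hx => Set.indicator_of_notMem hx v
  set K : Set Plane := {x | ε ≤ |w x|} with hKdef
  have hKU : K ⊆ U := by
    intro x hx
    by_contra h
    have : ε ≤ |w x| := hx
    rw [hwU' x h, abs_zero] at this
    linarith
  have hKcl : IsClosed K := isClosed_le continuous_const hwc.abs
  have hK : IsCompact K := Metric.isCompact_of_isClosed_isBounded hKcl (hUb.subset hKU)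
  have hz : ∀ x ∉ K, softThreshold ε (w x) = 0 := fun x hx =>
    softThreshold_eq_zero hε (not_le.1 hx).le
  have hz' : ∀ x ∉ K, softThresholdDeriv ε (w x) = 0 := fun x hx =>
    softThresholdDeriv_eq_zero hε (not_le.1 hx).le
  have hD1 := contDiffOn_fderiv_of_contDiffOn hU hv2
  have hD2 : ContinuousOn (fderiv ℝ (fderiv ℝ v)) U :=
    hD1.continuousOn_fderiv_of_isOpen hU le_rfl
  have hDc : ContinuousOn (fun x => fderiv ℝ v x e) U :=
    hD1.continuousOn.clm_apply continuousOn_const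
  have hDDc : ContinuousOn (fun x => fderiv ℝ (fderiv ℝ v) x e e) U :=
    (hD2.clm_apply continuousOn_const).clm_apply continuousOn_const
  have hφc : Continuous fun x => softThreshold ε (w x) := (continuous_softThreshold ε).comp hwc
  have hφ'c : Continuous fun x => softThresholdDeriv ε (w x) :=
    (continuous_softThresholdDeriv ε).comp hwc
  have hI1 : Integrable (fun x => softThresholdDeriv ε (w x) * fderiv ℝ v x e ^ 2) :=
    integrable_of_continuousOn_of_eq_zero hK hKU (hφ'c.continuousOn.mul (hDc.pow 2))
      fun x hx => by simp [hz' x hx]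
  have hI2 : Integrable (fun x => softThreshold ε (w x) * fderiv ℝ (fderiv ℝ v) x e e) :=
    integrable_of_continuousOn_of_eq_zero hK hKU (hφc.continuousOn.mul hDDc)
      fun x hx => by simp [hz x hx]
  have hI3 : Integrable (fun x => softThreshold ε (w x) * fderiv ℝ v x e) :=
    integrable_of_continuousOn_of_eq_zero hK hKU (hφc.continuousOn.mul hDc)
      fun x hx => by simp [hz x hx]
  have key := integral_bilinear_hasFDerivAt_right_eq_neg_left_of_integrable (μ := volume)
    (f := fun x => softThreshold ε (w x)) (f' := fun x => softThresholdDeriv ε (w x) • fderiv ℝ v x)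
    (g := fun x => fderiv ℝ v x e)
    (g' := fun x => (ContinuousLinearMap.apply ℝ ℝ e).comp (fderiv ℝ (fderiv ℝ v) x)) (v := e)
    (B := ContinuousLinearMap.mul ℝ ℝ)
    (by
      refine hI1.congr (Filter.Eventually.of_forall fun x => ?_)
      simp
      ring)
    (by simpa using hI2) (by simpa using hI3)
    (by
      intro x _
      by_cases hx : x ∈ U
      · have h1 : HasFDerivAt w (fderiv ℝ v x) x := by
          have h2 : HasFDerivAt v (fderiv ℝ v x) x :=
            ((hv2.contDiffAt (hU.mem_nhds hx)).differentiableAt (by norm_num)).hasFDerivAt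
          refine h2.congr_of_eventuallyEq ?_
          filter_upwards [hU.mem_nhds hx] with y hy using hwU y hy
        exact (hasDerivAt_softThreshold ε (w x)).comp_hasFDerivAt x h1
      · have hxK : x ∉ K := fun h => hx (hKU h)
        rw [hz' x hxK, zero_smul]
        refine (hasFDerivAt_const (0 : ℝ) x).congr_of_eventuallyEq ?_
        filter_upwards [hKcl.isOpen_compl.mem_nhds hxK] with y hy using hz y hy)
    (by
      intro x hx
      have hxK : x ∈ K := by
        refine closure_minimal (fun y hy => ?_) hKcl hx
        by_contra h
        exact hy (hz y h)
      have hxU := hKU hxK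
      exact (ContinuousLinearMap.apply ℝ ℝ e).hasFDerivAt.comp x
        ((hD1.contDiffAt (hU.mem_nhds hxU)).differentiableAt (by norm_num)).hasFDerivAt)
  have hit : ∀ x, iteratedFDeriv ℝ 2 v x ![e, e] = fderiv ℝ (fderiv ℝ v) x e e := by
    intro x
    simp [iteratedFDeriv_two_apply]
  simp only [hit]
  refine ⟨hI1, hI2, ?_⟩
  simp only [ContinuousLinearMap.mul_apply', ContinuousLinearMap.comp_apply,
    ContinuousLinearMap.apply_apply, smul_apply, smul_eq_mul] at key
  rw [key]
  congr 1
  refine integral_congr_ae (Filter.Eventually.of_forall fun x => ?_)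
  simp only
  ring

/-- A function that vanishes on the boundary of `U` and is `L²`-orthogonal to its (continuous)
Laplacian is zero. -/
theorem eq_zero_of_integral_mul_laplacian_eq_zero (hU : IsOpen U) (hUb : Bornology.IsBounded U)
    (hUc : IsPreconnected U) (hv : ContinuousOn v (closure U)) (hv2 : ContDiffOn ℝ 2 v U)
    (hv0 : ∀ x ∈ frontier U, v x = 0) {q : Plane → ℝ} (hq : Continuous q)
    (hlap : ∀ x ∈ U, Laplacian.laplacian v x = q x) (hint : ∫ x in U, v x * q x = 0) :
    ∀ x ∈ U, v x = 0 := by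
  set w := U.indicator v with hw
  have hwc : Continuous w := continuous_indicator hv0 hv
  have hwU : ∀ x ∈ U, w x = v x := fun x hx => Set.indicator_of_mem hx v
  have hwU' : ∀ x ∉ U, w x = 0 := fun x hx => Set.indicator_of_notMem hx v
  let b := EuclideanSpace.basisFun (Fin 2) ℝ
  have hcpt : IsCompact (closure U) := hUb.isCompact_closure
  have hintOn : ∀ {g : Plane → ℝ}, Continuous g → IntegrableOn g U := fun hg =>
    (hg.continuousOn.integrableOn_compact hcpt).mono_set subset_closure
  have hIBP : ∀ ε > 0, ∑ i, ∫ x, softThresholdDeriv ε (w x) * fderiv ℝ v x (b i) ^ 2 =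
      - ∫ x in U, softThreshold ε (w x) * q x := by
    intro ε hε
    have h := fun i => integral_softThreshold_mul_eq hU hUb hv hv2 hv0 hε (b i)
    rw [← hw] at h
    rw [← integral_indicator hU.measurableSet, ← neg_eq_iff_eq_neg, ← Finset.sum_neg_distrib,
      Finset.sum_congr rfl fun i _ => (h i).2.2.symm, ← integral_finsetSum _ fun i _ => (h i).2.1]
    refine integral_congr_ae (Filter.Eventually.of_forall fun x => ?_)
    simp only
    by_cases hx : x ∈ U
    · rw [Set.indicator_of_mem hx, ← hlap x hx,
        InnerProductSpace.laplacian_eq_iteratedFDeriv_orthonormalBasis v b, Finset.mul_sum]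
    · rw [Set.indicator_of_notMem hx]
      refine Finset.sum_eq_zero fun i _ => ?_
      rw [hwU' x hx, softThreshold_eq_zero hε (by simpa using hε.le), zero_mul]
  set C := ∫ x in U, |q x|
  -- Since `∫ w q = 0`, the truncation may be replaced by its difference from `w`, which is at most
  -- `2ε`.
  have hbound : ∀ ε > 0, - ∫ x in U, softThreshold ε (w x) * q x ≤ 2 * ε * C := by
    intro ε hε
    have hwq : ∫ x in U, w x * q x = 0 := by
      rw [← hint]
      exact setIntegral_congr_fun hU.measurableSet fun x hx => by simp only [hwU x hx]
    have h1 : - ∫ x in U, softThreshold ε (w x) * q x =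
        ∫ x in U, (w x - softThreshold ε (w x)) * q x := by
      simp only [sub_mul]
      have hI1 : IntegrableOn (fun x => w x * q x) U := hintOn (hwc.mul hq)
      have hI2 : IntegrableOn (fun x => softThreshold ε (w x) * q x) U :=
        hintOn (((continuous_softThreshold ε).comp hwc).mul hq)
      rw [integral_sub hI1 hI2, hwq, zero_sub]
    rw [h1, ← integral_const_mul]
    refine setIntegral_mono_on (hintOn ((hwc.sub ((continuous_softThreshold ε).comp hwc)).mul hq))
      ((hintOn hq.abs).const_mul _) hU.measurableSet fun x _ => ?_
    refine (le_abs_self _).trans ?_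
    rw [abs_mul, abs_sub_comm]
    exact mul_le_mul_of_nonneg_right (abs_softThreshold_sub_le hε _) (abs_nonneg _)
  have hC : 0 ≤ C := integral_nonneg fun _ => abs_nonneg _
  have hpart : ∀ ε > 0, ∀ i, ∫ x, softThresholdDeriv ε (w x) * fderiv ℝ v x (b i) ^ 2 = 0 := by
    intro ε hε i
    refine le_antisymm ?_ (integral_nonneg fun x =>
      mul_nonneg (softThresholdDeriv_nonneg _ _) (sq_nonneg _))
    refine le_of_forall_pos_le_add fun δ hδ => ?_
    -- The `+ 1` in the denominator covers `C = 0`. The integral at `ε` is at most the one at `ε'`,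
    -- hence at most `δ`.
    obtain ⟨ε', hε', hle, hsmall⟩ : ∃ ε' > 0, ε' ≤ ε ∧ 2 * ε' * C ≤ δ := by
      refine ⟨min ε (δ / (2 * C + 1)), by positivity, min_le_left _ _, ?_⟩
      have h1 : min ε (δ / (2 * C + 1)) ≤ δ / (2 * C + 1) := min_le_right _ _
      have h2 : δ / (2 * C + 1) * (2 * C + 1) = δ := by field_simp
      have h3 : 0 < δ / (2 * C + 1) := by positivity
      nlinarith
    rw [zero_add]
    refine le_trans ?_ hsmall
    refine le_trans ?_ (hbound ε' hε')
    rw [← hIBP ε' hε']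
    refine le_trans (integral_mono (integral_softThreshold_mul_eq hU hUb hv hv2 hv0 hε _).1
      (integral_softThreshold_mul_eq hU hUb hv hv2 hv0 hε' _).1 fun x => ?_)
      (Finset.single_le_sum
        (f := fun i => ∫ x, softThresholdDeriv ε' (w x) * fderiv ℝ v x (b i) ^ 2)
        (fun j _ => integral_nonneg fun x =>
          mul_nonneg (softThresholdDeriv_nonneg _ _) (sq_nonneg _)) (Finset.mem_univ i))
    exact mul_le_mul_of_nonneg_right (softThresholdDeriv_anti hε' hle _) (sq_nonneg _)
  have hgrad : ∀ x ∈ U, v x ≠ 0 → fderiv ℝ v x = 0 := by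
    -- The threshold `|v x| / 2` makes the cut-off equal to `1` at `x`.
    intro x hx hvx
    have hε : 0 < |v x| / 2 := by positivity
    set ε := |v x| / 2 with hεdef
    have hcoord : ∀ i, fderiv ℝ v x (b i) = 0 := by
      intro i
      have hnn : ∀ y, 0 ≤ softThresholdDeriv ε (w y) * fderiv ℝ v y (b i) ^ 2 := fun y =>
        mul_nonneg (softThresholdDeriv_nonneg _ _) (sq_nonneg _)
      have hae := (integral_eq_zero_iff_of_nonneg hnn
        (integral_softThreshold_mul_eq hU hUb hv hv2 hv0 hε (b i)).1).1 (hpart ε hε i)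
      have hD1 := contDiffOn_fderiv_of_contDiffOn hU hv2
      have hcont : ContinuousOn (fun y => softThresholdDeriv ε (w y) * fderiv ℝ v y (b i) ^ 2) U :=
        ((continuous_softThresholdDeriv ε).comp hwc).continuousOn.mul
          ((hD1.continuousOn.clm_apply continuousOn_const).pow 2)
      have := Measure.eqOn_open_of_ae_eq (ae_restrict_of_ae hae) hU hcont continuousOn_const hx
      simp only [Pi.zero_apply] at this
      rw [softThresholdDeriv_eq_one hε (by rw [hwU x hx, hεdef]; linarith), one_mul] at this
      exact pow_eq_zero_iff (two_ne_zero) |>.1 this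
    ext y
    rw [← b.sum_repr y]
    simp [hcoord]
  have hdiff : ∀ x ∈ U, DifferentiableAt ℝ v x := fun x hx =>
    (hv2.contDiffAt (hU.mem_nhds hx)).differentiableAt (by norm_num)
  -- The gradient `2 v ∇v` of `v²` vanishes everywhere, also at the zeros of `v`, where `∇v` has not
  -- been determined.
  obtain ⟨c, hc⟩ := hU.exists_is_const_of_fderiv_eq_zero (𝕜 := ℝ) (f := fun x => v x ^ 2) hUc
    (fun x hx => ((hdiff x hx).pow 2).differentiableWithinAt)
    (fun x hx => by
      have h1 := ((hdiff x hx).hasFDerivAt.pow 2).fderiv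
      rw [h1]
      by_cases h0 : v x = 0
      · simp [h0]
      · simp [hgrad x hx h0])
  by_cases hc0 : c = 0
  · intro x hx
    have := hc x hx
    rw [hc0] at this
    exact pow_eq_zero_iff (two_ne_zero) |>.1 this
  -- If `v²` were a nonzero constant, this level set of the continuous `w²` would make `U` closed as
  -- well as open, impossible for a bounded nonempty `U`.
  have hset : U = {x | w x ^ 2 = c} := by
    ext x
    refine ⟨fun hx => ?_, fun hx => ?_⟩
    · change w x ^ 2 = c
      rw [hwU x hx, hc x hx]
    · by_contra h
      have hx' : w x ^ 2 = c := hx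
      rw [hwU' x h] at hx'
      exact hc0 (by rw [← hx']; norm_num)
  have hclosed : IsClosed U := by
    rw [hset]
    exact isClosed_eq (hwc.pow 2) continuous_const
  rcases isClopen_iff.1 ⟨hclosed, hU⟩ with h | h
  · simp [h]
  · rw [h] at hUb
    exact absurd hUb (NormedSpace.unbounded_univ ℝ Plane)

end

/-! ### The serendipity space as a finite-dimensional normed space -/

section

variable {N : ℕ} {P : Polygon Plane N} {k : ℕ}
  {m : Module.Basis (Fin (polyDim k)) ℝ (PolySpace k)}

theorem integrableOn_element {g : Plane → ℝ} (hg : ContinuousOn g (closure (element P))) :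
    IntegrableOn g (element P) :=
  (hg.integrableOn_compact isCompact_closure_element).mono_set subset_closure

theorem memLp_element {g : Plane → ℝ} (hg : ContinuousOn g (closure (element P))) :
    MemLp g 2 (volume.restrict (element P)) := by
  have hmeas : AEStronglyMeasurable g (volume.restrict (element P)) :=
    (integrableOn_element hg).aestronglyMeasurable
  rw [memLp_two_iff_integrable_sq hmeas]
  exact integrableOn_element (hg.pow 2)

theorem memLp_polyFun (p : MvPolynomial (Fin 2) ℝ) :
    MemLp (polyFun p) 2 (volume.restrict (element P)) :=
  memLp_element (continuous_polyFun p).continuousOn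

theorem moment_add {q : MvPolynomial (Fin 2) ℝ} {g h : Plane → ℝ}
    (hg : ContinuousOn g (closure (element P))) (hh : ContinuousOn h (closure (element P))) :
    moment (element P) q (g + h) = moment (element P) q g + moment (element P) q h := by
  have hq := (continuous_polyFun q).continuousOn (s := closure (element P))
  have h1 : IntegrableOn (fun x => g x * polyFun q x) (element P) :=
    integrableOn_element (hg.mul hq)
  have h2 : IntegrableOn (fun x => h x * polyFun q x) (element P) :=
    integrableOn_element (hh.mul hq)
  simp only [moment, Pi.add_apply, add_mul]
  rw [integral_add h1 h2, mul_add]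

theorem moment_smul (q : MvPolynomial (Fin 2) ℝ) (c : ℝ) (g : Plane → ℝ) (E : Set Plane) :
    moment E q (c • g) = c * moment E q g := by
  simp only [moment, Pi.smul_apply, smul_eq_mul, mul_assoc]
  rw [integral_const_mul]
  ring

theorem chi_add {g h : Plane → ℝ}
    (hg : ContinuousOn g (closure (element P))) (hh : ContinuousOn h (closure (element P))) :
    chi P k m (g + h) = chi P k m g + chi P k m h := by
  ext i
  rcases i with i | α
  · simp [chi]
  · simpa [chi] using moment_add hg hh

theorem chi_smul (c : ℝ) (g : Plane → ℝ) : chi P k m (c • g) = c • chi P k m g := by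
  ext i
  rcases i with i | α
  · simp [chi]
  · simpa [chi] using moment_smul _ c g _

theorem chi_polyFun_add (p q : MvPolynomial (Fin 2) ℝ) :
    chi P k m (polyFun (p + q)) = chi P k m (polyFun p) + chi P k m (polyFun q) := by
  rw [← chi_add (continuous_polyFun p).continuousOn (continuous_polyFun q).continuousOn]
  congr 1
  ext x
  exact polyFun_add p q x

theorem chi_polyFun_smul (c : ℝ) (p : MvPolynomial (Fin 2) ℝ) :
    chi P k m (polyFun (c • p)) = c • chi P k m (polyFun p) := by
  rw [← chi_smul]
  congr 1
  ext x
  exact polyFun_smul c p x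

theorem continuousOn_of_mem_serendipitySpace {v : Plane → ℝ} (hv : v ∈ serendipitySpace P k m) :
    ContinuousOn v (closure (element P)) := hv.1.1

theorem IsSerendipityProj.add {v w : Plane → ℝ} {p q : MvPolynomial (Fin 2) ℝ}
    (hv : ContinuousOn v (closure (element P))) (hw : ContinuousOn w (closure (element P)))
    (hp : IsSerendipityProj P k m v p) (hq : IsSerendipityProj P k m w q) :
    IsSerendipityProj P k m (v + w) (p + q) := by
  refine ⟨Submodule.add_mem _ hp.1 hq.1, fun α => ?_⟩
  simp only [chi_polyFun_add, chi_add hv hw, Pi.add_apply, add_mul, Finset.sum_add_distrib,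
    hp.2 α, hq.2 α]

theorem IsSerendipityProj.smul {v : Plane → ℝ} {p : MvPolynomial (Fin 2) ℝ} (c : ℝ)
    (hp : IsSerendipityProj P k m v p) : IsSerendipityProj P k m (c • v) (c • p) := by
  refine ⟨Submodule.smul_mem _ _ hp.1, fun α => ?_⟩
  simp only [chi_polyFun_smul, chi_smul, Pi.smul_apply, smul_eq_mul, mul_assoc, ← Finset.mul_sum,
    hp.2 α]

theorem isSerendipityProj_polyFun {p : MvPolynomial (Fin 2) ℝ} (hp : p ∈ PolySpace k) :
    IsSerendipityProj P k m (polyFun p) p := ⟨hp, fun _ => rfl⟩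

theorem const_mem_serendipitySpace (c : ℝ) : (fun _ => c) ∈ serendipitySpace P k m := by
  have hC : (fun _ => c) = polyFun (MvPolynomial.C c) := by
    ext x
    simp [polyFun]
  refine ⟨⟨continuousOn_const, fun i => ⟨Polynomial.C c, by simp⟩, contDiffOn_const, 0,
    Submodule.zero_mem _, fun x _ => ?_⟩, MvPolynomial.C c, ?_, fun α _ => by simp [polyFun]⟩
  · simp [polyFun]
  · rw [hC]
    exact isSerendipityProj_polyFun (mem_polySpace.2 (by simp))

variable (P k m) in
/-- The serendipity space as a vector space. -/
def serendipitySubmodule : Submodule ℝ (Plane → ℝ) where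
  carrier := serendipitySpace P k m
  zero_mem' := const_mem_serendipitySpace 0
  add_mem' := by
    rintro v w ⟨⟨hv, hve, hv2, pv, hpv, hvl⟩, qv, hqv, hvm⟩
      ⟨⟨hw, hwe, hw2, pw, hpw, hwl⟩, qw, hqw, hwm⟩
    refine ⟨⟨hv.add hw, fun i => ?_, hv2.add hw2, pv + pw, Submodule.add_mem _ hpv hpw,
      fun x hx => ?_⟩, qv + qw, hqv.add hv hw hqw, fun α hα => ?_⟩
    · obtain ⟨a, ha, hav⟩ := hve i
      obtain ⟨b, hb, hbw⟩ := hwe i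
      refine ⟨a + b, (Polynomial.natDegree_add_le a b).trans (max_le ha hb), fun t ht => ?_⟩
      simp [hav t ht, hbw t ht]
    · rw [(hv2.contDiffAt (isOpen_element.mem_nhds hx)).laplacian_add
        (hw2.contDiffAt (isOpen_element.mem_nhds hx)), hvl x hx, hwl x hx, polyFun_add]
    · have hc : ∀ q, ContinuousOn (polyFun q) (closure (element P)) := fun q =>
        (continuous_polyFun q).continuousOn
      have h1 : IntegrableOn (fun x => (v x - polyFun qv x) * polyFun (m α) x) (element P) :=
        integrableOn_element ((hv.sub (hc _)).mul (hc _))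
      have h2 : IntegrableOn (fun x => (w x - polyFun qw x) * polyFun (m α) x) (element P) :=
        integrableOn_element ((hw.sub (hc _)).mul (hc _))
      have h3 := integral_add h1 h2
      rw [hvm α hα, hwm α hα, add_zero] at h3
      rw [← h3]
      refine integral_congr_ae (Filter.Eventually.of_forall fun x => ?_)
      simp only [Pi.add_apply, polyFun_add]
      ring
  smul_mem' := by
    rintro c v ⟨⟨hv, hve, hv2, pv, hpv, hvl⟩, qv, hqv, hvm⟩
    refine ⟨⟨hv.const_smul c, fun i => ?_, hv2.const_smul c, c • pv, Submodule.smul_mem _ _ hpv,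
      fun x hx => ?_⟩, c • qv, hqv.smul c, fun α hα => ?_⟩
    · obtain ⟨a, ha, hav⟩ := hve i
      refine ⟨c • a, (Polynomial.natDegree_smul_le c a).trans ha, fun t ht => ?_⟩
      simp [hav t ht]
    · rw [InnerProductSpace.laplacian_smul c (hv2.contDiffAt (isOpen_element.mem_nhds hx)),
        hvl x hx, polyFun_smul, smul_eq_mul]
    · have h3 := hvm α hα
      rw [← mul_zero c, ← h3, ← integral_const_mul]
      refine integral_congr_ae (Filter.Eventually.of_forall fun x => ?_)
      simp only [Pi.smul_apply, smul_eq_mul, polyFun_smul]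
      ring

variable (P k m) in
/-- The degrees of freedom, as a linear map. -/
def chiLinear : serendipitySubmodule P k m →ₗ[ℝ]
    EuclideanSpace ℝ (BdryIndex N k ⊕ MomIndex P k) where
  toFun v := WithLp.toLp 2 (chi P k m v)
  map_add' v w := by
    rw [Submodule.coe_add, chi_add (continuousOn_of_mem_serendipitySpace v.2)
      (continuousOn_of_mem_serendipitySpace w.2), WithLp.toLp_add]
  map_smul' c v := by
    rw [Submodule.coe_smul, chi_smul, WithLp.toLp_smul, RingHom.id_apply]

theorem norm_chiLinear (v : serendipitySubmodule P k m) :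
    ‖chiLinear P k m v‖ = chiNorm P k m v := by
  simp [EuclideanSpace.norm_eq, chiNorm, chiLinear]

variable (P k m) in
/-- The inclusion of the serendipity space into `L²(E)`. -/
def l2Linear : serendipitySubmodule P k m →ₗ[ℝ] Lp ℝ 2 (volume.restrict (element P)) where
  toFun v := (memLp_element (continuousOn_of_mem_serendipitySpace v.2)).toLp v
  map_add' v w := MemLp.toLp_add (memLp_element (continuousOn_of_mem_serendipitySpace v.2))
    (memLp_element (continuousOn_of_mem_serendipitySpace w.2))
  map_smul' c v := MemLp.toLp_const_smul c
    (memLp_element (continuousOn_of_mem_serendipitySpace v.2))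

theorem norm_l2Linear (v : serendipitySubmodule P k m) :
    ‖l2Linear P k m v‖ = l2norm (element P) v := by
  simp [l2Linear, l2norm, Lp.norm_toLp]

theorem l2Linear_eq_zero_iff {v : serendipitySubmodule P k m} :
    l2Linear P k m v = 0 ↔ (v : Plane → ℝ) =ᵐ[volume.restrict (element P)] 0 :=
  MemLp.toLp_eq_toLp_iff (memLp_element (continuousOn_of_mem_serendipitySpace v.2)) MemLp.zero

end

/-! ### Unisolvence -/

section

variable {N : ℕ} {P : Polygon Plane N} {k : ℕ}
  {m : Module.Basis (Fin (polyDim k)) ℝ (PolySpace k)}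

/-- The functional `q ↦ ∫_E v q` vanishes on the span of a set on which it vanishes. -/
theorem integral_mul_polyFun_eq_zero_of_mem_span {v : Plane → ℝ}
    (hv : ContinuousOn v (closure (element P))) {S : Set (MvPolynomial (Fin 2) ℝ)}
    (hS : ∀ q ∈ S, ∫ x in element P, v x * polyFun q x = 0) {q : MvPolynomial (Fin 2) ℝ}
    (hq : q ∈ Submodule.span ℝ S) : ∫ x in element P, v x * polyFun q x = 0 := by
  have hint : ∀ q, IntegrableOn (fun x => v x * polyFun q x) (element P) := fun q =>
    integrableOn_element (hv.mul (continuous_polyFun q).continuousOn)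
  induction hq using Submodule.span_induction with
  | mem q hq => exact hS q hq
  | zero => simp [polyFun]
  | add p q _ _ hp hq =>
    simp only [polyFun_add, mul_add]
    rw [integral_add (hint p) (hint q), hp, hq, add_zero]
  | smul c q _ hq =>
    simp only [polyFun_smul, mul_left_comm _ c]
    rw [integral_const_mul, hq, mul_zero]

theorem span_range_coe_basis (m : Module.Basis (Fin (polyDim k)) ℝ (PolySpace k)) :
    Submodule.span ℝ (Set.range fun α => (m α : MvPolynomial (Fin 2) ℝ)) = PolySpace k := by
  have h := congrArg (Submodule.map (PolySpace k).subtype) m.span_eq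
  rw [Submodule.map_span, Submodule.map_top, Submodule.range_subtype, ← Set.range_comp] at h
  exact h

/-- The basis serves to make `P_k` finite-dimensional, as monotonicity of `finrank` requires. -/
theorem polyDim_mono (m : Module.Basis (Fin (polyDim k)) ℝ (PolySpace k)) {d : ℕ} (hd : d ≤ k) :
    polyDim d ≤ polyDim k := by
  have : Module.Finite ℝ (PolySpace k) := Module.Finite.of_basis m
  exact Submodule.finrank_mono (polySpace_mono hd)

theorem card_momIndex (m : Module.Basis (Fin (polyDim k)) ℝ (PolySpace k)) :
    Fintype.card (MomIndex P k) = polyDim (k - eta P) := by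
  have h := polyDim_mono m (Nat.sub_le k (eta P))
  rw [Fintype.card_subtype]
  have : (Finset.univ.filter fun α : Fin (polyDim k) => (α : ℕ) < polyDim (k - eta P)) =
      (Finset.univ : Finset (Fin (polyDim (k - eta P)))).map (Fin.castLEEmb h) := by
    ext α
    simp only [Finset.mem_filter, Finset.mem_univ, true_and, Finset.mem_map]
    exact ⟨fun hα => ⟨⟨α, hα⟩, rfl⟩, by rintro ⟨β, rfl⟩; exact β.2⟩
  rw [this]
  simp

/-- The elements of the basis that belong to `P_{k - η}` span that space. -/
theorem span_momIndex
    (hm : ∀ α : Fin (polyDim k), (α : ℕ) < polyDim (k - eta P) →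
      (m α : MvPolynomial (Fin 2) ℝ) ∈ PolySpace (k - eta P)) :
    Submodule.span ℝ (Set.range fun α : MomIndex P k => (m α : MvPolynomial (Fin 2) ℝ)) =
      PolySpace (k - eta P) := by
  have : Module.Finite ℝ (PolySpace k) := Module.Finite.of_basis m
  have hfin : Module.Finite ℝ (PolySpace (k - eta P)) :=
    Submodule.finiteDimensional_of_le (polySpace_mono (Nat.sub_le k (eta P)))
  have hli : LinearIndependent ℝ fun α : MomIndex P k => (m α : MvPolynomial (Fin 2) ℝ) :=
    (m.linearIndependent.map' (PolySpace k).subtype (Submodule.ker_subtype _)).comp _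
      Subtype.val_injective
  -- Linearly independent elements, as many as the dimension.
  refine Submodule.eq_of_le_of_finrank_le ?_ ?_
  · rw [Submodule.span_le]
    rintro _ ⟨α, rfl⟩
    exact hm α α.2
  · rw [finrank_span_eq_card hli, card_momIndex m]
    exact le_rfl

namespace IsConvexPolygon

theorem integral_mul_eq_zero_of_chi_eq_zero (hP : IsConvexPolygon P)
    {v : Plane → ℝ} (h : chi P k m v = 0) (α : MomIndex P k) :
    ∫ x in element P, v x * polyFun (m α) x = 0 := by
  have := congrFun h (Sum.inr α)
  simp only [chi, Sum.elim_inr, moment, Pi.zero_apply, mul_eq_zero, inv_eq_zero] at this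
  exact this.resolve_left hP.volume_element_pos.ne'

/-- A polynomial of degree at most `k` with vanishing degrees of freedom is zero. -/
theorem eq_zero_of_chi_polyFun_eq_zero (hP : IsConvexPolygon P) (hk : eta P ≤ k)
    (hm : ∀ α : Fin (polyDim k), (α : ℕ) < polyDim (k - eta P) →
      (m α : MvPolynomial (Fin 2) ℝ) ∈ PolySpace (k - eta P))
    {p : MvPolynomial (Fin 2) ℝ} (hp : p ∈ PolySpace k) (h : chi P k m (polyFun p) = 0) :
    p = 0 := by
  obtain ⟨l, q, rfl, hq, hl⟩ := hP.exists_eq_mul_of_node_eq_zero hk hp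
    (fun i => congrFun h (Sum.inl i))
  have hint : ∫ x in element P, polyFun (l * q) x * polyFun q x = 0 :=
    integral_mul_polyFun_eq_zero_of_mem_span (continuous_polyFun _).continuousOn
      (S := Set.range fun α : MomIndex P k => (m α : MvPolynomial (Fin 2) ℝ))
      (by rintro _ ⟨α, rfl⟩; exact hP.integral_mul_eq_zero_of_chi_eq_zero h α)
      (by rw [span_momIndex hm]; exact hq)
  have hcont : Continuous fun x => polyFun (l * q) x * polyFun q x :=
    (continuous_polyFun _).mul (continuous_polyFun _)
  have heq : ∀ x, polyFun (l * q) x * polyFun q x = polyFun l x * polyFun q x ^ 2 := fun x => by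
    rw [polyFun_mul]; ring
  have hae := (setIntegral_eq_zero_iff_of_nonneg_ae
    ((ae_restrict_iff' isOpen_element.measurableSet).2 (Filter.Eventually.of_forall fun x hx => by
      simp only [heq, Pi.zero_apply]
      exact mul_nonneg (hl x hx).le (sq_nonneg _)))
    (integrableOn_element hcont.continuousOn)).1 hint
  have hon := Measure.eqOn_open_of_ae_eq hae isOpen_element hcont.continuousOn continuousOn_const
  have hq0 : q = 0 := by
    refine eq_zero_of_polyFun_eqOn_zero isOpen_element hP.element_nonempty fun x hx => ?_
    have := hon hx
    simp only [heq, Pi.zero_apply, mul_eq_zero, (hl x hx).ne', false_or] at this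
    exact pow_eq_zero_iff two_ne_zero |>.1 this
  rw [hq0, mul_zero]

/-- The defining equations make `χ(p)` orthogonal to `χ(q)` for all `q ∈ P_k`, in particular to
itself. -/
theorem isSerendipityProj_eq_zero (hP : IsConvexPolygon P) (hk : eta P ≤ k)
    (hm : ∀ α : Fin (polyDim k), (α : ℕ) < polyDim (k - eta P) →
      (m α : MvPolynomial (Fin 2) ℝ) ∈ PolySpace (k - eta P))
    {v : Plane → ℝ} {p : MvPolynomial (Fin 2) ℝ} (hp : IsSerendipityProj P k m v p)
    (h : chi P k m v = 0) : p = 0 := by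
  refine hP.eq_zero_of_chi_polyFun_eq_zero hk hm hp.1 ?_
  have hall : ∀ q ∈ Submodule.span ℝ (Set.range fun α => (m α : MvPolynomial (Fin 2) ℝ)),
      ∑ i, chi P k m (polyFun p) i * chi P k m (polyFun q) i = 0 := by
    intro q hq
    induction hq using Submodule.span_induction with
    | mem q hq =>
      obtain ⟨α, rfl⟩ := hq
      simpa [h] using hp.2 α
    | zero =>
      have : chi P k m (polyFun 0) = 0 := by simpa using chi_polyFun_smul (m := m) (P := P) 0 0
      simp [this]
    | add q r _ _ hq hr => simp [chi_polyFun_add, mul_add, Finset.sum_add_distrib, hq, hr]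
    | smul c q _ hq => simp [chi_polyFun_smul, mul_left_comm _ c, ← Finset.mul_sum, hq]
  have hpp := hall p (by rw [span_range_coe_basis]; exact hp.1)
  ext i
  exact mul_self_eq_zero.1
    ((Finset.sum_eq_zero_iff_of_nonneg fun i _ => mul_self_nonneg _).1 hpp i (Finset.mem_univ i))

/-- The degrees of freedom determine the functions of the serendipity space. -/
theorem eqOn_zero_of_chi_eq_zero (hP : IsConvexPolygon P) (hk : eta P ≤ k)
    (hm : ∀ α : Fin (polyDim k), (α : ℕ) < polyDim (k - eta P) →
      (m α : MvPolynomial (Fin 2) ℝ) ∈ PolySpace (k - eta P))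
    {v : Plane → ℝ} (hv : v ∈ serendipitySpace P k m) (h : chi P k m v = 0) :
    ∀ x ∈ closure (element P), v x = 0 := by
  have hk1 : 1 ≤ k := hP.one_le_eta.trans hk
  obtain ⟨⟨hvc, hedge, hv2, q, hq, hlap⟩, p, hp, hmom⟩ := hv
  have hp0 : p = 0 := hP.isSerendipityProj_eq_zero hk hm hp h
  have hfr : ∀ x ∈ frontier (element P), v x = 0 := by
    intro x hx
    obtain ⟨i, t, ht, rfl⟩ := hP.mem_frontier_iff.1 hx
    obtain ⟨r, hr, hvr⟩ := hedge i
    have hr0 : r = 0 := by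
      refine eq_zero_of_eval_edgeParams hk1 hr (fun t ht => ?_) ?_
      · rw [← hvr t (Set.Ico_subset_Icc_self (edgeParams_mem_Ico ht))]
        exact congrFun h (Sum.inl (i, ⟨t, ht⟩))
      · have h1 := congrFun h (Sum.inl (finRotate N i, ⟨0, Finset.mem_insert_self _ _⟩))
        rw [← hvr 1 (by simp)]
        simpa [chi, node, edgePath_eq] using h1
    rw [hvr t ht, hr0, Polynomial.eval_zero]
  -- Low moments are degrees of freedom; high ones vanish because `π^S v = 0`. Hence `v` is
  -- orthogonal to all of `P_k`, which contains its Laplacian.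
  have horth : ∫ x in element P, v x * polyFun q x = 0 := by
    refine integral_mul_polyFun_eq_zero_of_mem_span hvc (S := Set.range fun α =>
      (m α : MvPolynomial (Fin 2) ℝ)) ?_ (by rw [span_range_coe_basis]; exact hq)
    rintro _ ⟨α, rfl⟩
    by_cases hα : (α : ℕ) < polyDim (k - eta P)
    · exact hP.integral_mul_eq_zero_of_chi_eq_zero h ⟨α, hα⟩
    · simpa [hp0, polyFun] using hmom α (not_lt.1 hα)
  have hin := eq_zero_of_integral_mul_laplacian_eq_zero isOpen_element isBounded_element
    convex_element.isPreconnected hvc hv2 hfr (continuous_polyFun q) hlap horth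
  intro x hx
  rw [closure_eq_self_union_frontier] at hx
  exact hx.elim (hin x) (hfr x)

/-- Elements of the space are functions on the whole plane, arbitrary off the closure of `E`, so
neither kernel is trivial: both consist of the elements that vanish on that closure. For the `L²`
kernel, continuity passes from almost everywhere in `E` to the boundary nodes. -/
theorem ker_chiLinear_eq_ker_l2Linear (hP : IsConvexPolygon P) (hk : eta P ≤ k)
    (hm : ∀ α : Fin (polyDim k), (α : ℕ) < polyDim (k - eta P) →
      (m α : MvPolynomial (Fin 2) ℝ) ∈ PolySpace (k - eta P)) :
    LinearMap.ker (chiLinear P k m) = LinearMap.ker (l2Linear P k m) := by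
  ext v
  rw [LinearMap.mem_ker, LinearMap.mem_ker]
  constructor
  · intro h
    have hchi : chi P k m v = 0 := congrArg WithLp.ofLp h
    have h0 := hP.eqOn_zero_of_chi_eq_zero hk hm v.2 hchi
    rw [l2Linear_eq_zero_iff]
    exact (ae_restrict_iff' isOpen_element.measurableSet).2
      (Filter.Eventually.of_forall fun x hx => h0 x (subset_closure hx))
  · intro h
    rw [l2Linear_eq_zero_iff] at h
    have hvc := continuousOn_of_mem_serendipitySpace v.2
    have h0 := Measure.eqOn_open_of_ae_eq h isOpen_element (hvc.mono subset_closure)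
      continuousOn_const
    have h1 : Set.EqOn (v : Plane → ℝ) 0 (closure (element P)) :=
      h0.of_subset_closure hvc continuousOn_const subset_closure subset_rfl
    have hchi : chi P k m v = 0 := by
      ext i
      rcases i with i | α
      · exact h1 (hP.node_mem_closure i)
      · simp only [chi, Sum.elim_inr, moment, Pi.zero_apply]
        rw [setIntegral_congr_fun (g := fun _ => 0) isOpen_element.measurableSet fun x hx => by
          simp only [h0 hx, Pi.zero_apply, zero_mul]]
        simp
    simp [chiLinear, hchi]

end IsConvexPolygon

/-! ### Existence of the norm-equivalence constants. -/

/-- Two linear maps with the same kernel have equivalent norms, if one has values in a space of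
finite dimension. -/
theorem exists_norm_le_norm_le_of_ker_eq {V A B : Type*} [AddCommGroup V] [Module ℝ V]
    [NormedAddCommGroup A] [NormedSpace ℝ A] [FiniteDimensional ℝ A]
    [NormedAddCommGroup B] [NormedSpace ℝ B] (f : V →ₗ[ℝ] A) (g : V →ₗ[ℝ] B)
    (h : LinearMap.ker f = LinearMap.ker g) :
    ∃ c C : ℝ, 0 < c ∧ 0 < C ∧ ∀ v, c * ‖f v‖ ≤ ‖g v‖ ∧ ‖g v‖ ≤ C * ‖f v‖ := by
  -- `g` factors through the range of `f` by an injective map, which is bounded above and below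
  -- because its domain is finite-dimensional.
  let e : LinearMap.range f →ₗ[ℝ] B :=
    ((LinearMap.ker f).liftQ g h.le).comp f.quotKerEquivRange.symm.toLinearMap
  have he : ∀ v, e ⟨f v, LinearMap.mem_range_self f v⟩ = g v := by
    intro v
    have : f.quotKerEquivRange.symm ⟨f v, LinearMap.mem_range_self f v⟩ =
        (LinearMap.ker f).mkQ v := f.quotKerEquivRange_symm_apply_image v _
    simp [e, this]
  have hker : LinearMap.ker e = ⊥ := by
    rw [LinearMap.ker_eq_bot']
    rintro ⟨_, v, rfl⟩ hv
    rw [he, ← LinearMap.mem_ker, ← h, LinearMap.mem_ker] at hv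
    exact Subtype.ext hv
  obtain ⟨K, hK, hanti⟩ := e.exists_antilipschitzWith hker
  let e' := LinearMap.toContinuousLinearMap e
  -- The `+ 1` keeps the constant positive when `e' = 0`.
  refine ⟨(K : ℝ)⁻¹, ‖e'‖ + 1, by positivity, by positivity, fun v => ⟨?_, ?_⟩⟩
  · have := hanti.le_mul_dist ⟨f v, LinearMap.mem_range_self f v⟩ 0
    rw [map_zero, dist_zero_right, dist_zero_right, he] at this
    rw [inv_mul_le_iff₀ (by positivity)]
    exact this
  · have := e'.le_opNorm ⟨f v, LinearMap.mem_range_self f v⟩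
    have h2 : e' ⟨f v, LinearMap.mem_range_self f v⟩ = g v := he v
    rw [h2] at this
    refine this.trans ?_
    exact mul_le_mul_of_nonneg_right (by linarith) (norm_nonneg _)

/-- The constants may depend on `E`, so its positive diameter is absorbed into them. -/
theorem IsConvexPolygon.exists_normEquivalence (hP : IsConvexPolygon P) (hk : eta P ≤ k)
    (hm : ∀ α : Fin (polyDim k), (α : ℕ) < polyDim (k - eta P) →
      (m α : MvPolynomial (Fin 2) ℝ) ∈ PolySpace (k - eta P)) :
    ∃ c₁ c₂ : ℝ, NormEquivalence P k m c₁ c₂ := by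
  obtain ⟨c, C, hc, hC, h⟩ := exists_norm_le_norm_le_of_ker_eq _ _
    (hP.ker_chiLinear_eq_ker_l2Linear hk hm)
  have hd := hP.diam_element_pos
  refine ⟨c / Metric.diam (element P), C / Metric.diam (element P), by positivity, by positivity,
    fun v hv => ?_⟩
  have := h ⟨v, hv⟩
  rw [norm_chiLinear, norm_l2Linear] at this
  rw [div_mul_cancel₀ _ hd.ne', div_mul_cancel₀ _ hd.ne']
  exact this

end

/-! ### The `L²` projection -/

section

variable {E : Set Plane}

theorem l2norm_nonneg (E : Set Plane) (g : Plane → ℝ) : 0 ≤ l2norm E g := ENNReal.toReal_nonneg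

theorem sq_l2norm {g : Plane → ℝ} (hg : MemLp g 2 (volume.restrict E)) :
    l2norm E g ^ 2 = ∫ x in E, g x ^ 2 := by
  have h1 : l2norm E g = ‖hg.toLp g‖ := by rw [Lp.norm_toLp, l2norm]
  rw [h1, ← real_inner_self_eq_norm_sq, L2.inner_def]
  refine integral_congr_ae ?_
  filter_upwards [hg.coeFn_toLp] with x hx
  rw [hx, real_inner_self_eq_norm_sq, Real.norm_eq_abs, sq_abs]

theorem l2norm_sub_le {g h : Plane → ℝ} (hg : MemLp g 2 (volume.restrict E))
    (hh : MemLp h 2 (volume.restrict E)) :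
    l2norm E (fun x => g x - h x) ≤ l2norm E g + l2norm E h := by
  have h1 : l2norm E g = ‖hg.toLp g‖ := by rw [Lp.norm_toLp, l2norm]
  have h2 : l2norm E h = ‖hh.toLp h‖ := by rw [Lp.norm_toLp, l2norm]
  have h3 : l2norm E (fun x => g x - h x) = ‖(hg.sub hh).toLp (g - h)‖ := by
    rw [Lp.norm_toLp, l2norm]
    rfl
  rw [h1, h2, h3, MemLp.toLp_sub]
  exact norm_sub_le _ _

/-- The Cauchy–Schwarz inequality for `|g|` and `1`. -/
theorem integral_abs_le_sqrt_mul_l2norm (hE : volume E ≠ ⊤) (hE0 : 0 < volume.real E)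
    {g : Plane → ℝ} (hg : MemLp g 2 (volume.restrict E)) :
    ∫ x in E, |g x| ≤ Real.sqrt (volume.real E) * l2norm E g := by
  have : IsFiniteMeasure (volume.restrict E) := ⟨by simpa [lt_top_iff_ne_top] using hE⟩
  have hg1 : Integrable (fun x => |g x|) (volume.restrict E) := (hg.integrable one_le_two).abs
  have hg2 : Integrable (fun x => g x ^ 2) (volume.restrict E) := hg.integrable_sq
  set I := ∫ x in E, |g x|
  set A := volume.real E
  -- The variance of `|g|` about its mean is nonnegative; expanding it gives the inequality.
  have hpos : 0 ≤ ∫ x in E, (|g x| - I / A) ^ 2 := integral_nonneg fun _ => sq_nonneg _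
  have hexp : ∫ x in E, (|g x| - I / A) ^ 2 =
      (∫ x in E, g x ^ 2) - 2 * (I / A) * I + (I / A) ^ 2 * A := by
    have h1 : ∀ x, (|g x| - I / A) ^ 2 = g x ^ 2 - 2 * (I / A) * |g x| + (I / A) ^ 2 := by
      intro x
      rw [sub_sq, sq_abs]
      ring
    have hi : Integrable (fun x => g x ^ 2 - 2 * (I / A) * |g x|) (volume.restrict E) :=
      hg2.sub (hg1.const_mul _)
    simp only [h1]
    rw [integral_add hi (integrable_const _),
      integral_sub hg2 (hg1.const_mul _), integral_const_mul, setIntegral_const, smul_eq_mul]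
    ring
  rw [hexp, ← sq_l2norm hg] at hpos
  have h2 : I ^ 2 ≤ A * l2norm E g ^ 2 := by
    have h3 : l2norm E g ^ 2 - 2 * (I / A) * I + (I / A) ^ 2 * A = l2norm E g ^ 2 - I ^ 2 / A := by
      field_simp
      ring
    rw [h3, sub_nonneg, div_le_iff₀ hE0] at hpos
    linarith
  refine le_of_sq_le_sq ?_ (mul_nonneg (Real.sqrt_nonneg _) (l2norm_nonneg _ _))
  rwa [mul_pow, Real.sq_sqrt hE0.le]

theorem l2Proj_mem (E : Set Plane) (k : ℕ) (u : Plane → ℝ) : l2Proj E k u ∈ PolySpace k := by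
  unfold l2Proj
  split_ifs with h
  · exact h.choose_spec.1
  · exact Submodule.zero_mem _

/-- The defining property of the `L²` projection. -/
theorem integral_l2Proj_sub_mul_eq_zero {k : ℕ} [Module.Finite ℝ (PolySpace k)]
    (hmem : ∀ p, MemLp (polyFun p) 2 (volume.restrict E)) {u : Plane → ℝ}
    (hu : MemLp u 2 (volume.restrict E)) {q : MvPolynomial (Fin 2) ℝ} (hq : q ∈ PolySpace k) :
    ∫ x in E, (polyFun (l2Proj E k u) x - u x) * polyFun q x = 0 := by
  have hex : ∃ p ∈ PolySpace k, ∀ q ∈ PolySpace k,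
      ∫ x in E, (polyFun p x - u x) * polyFun q x = 0 := by
    -- The image of `P_k` in `L²` is finite-dimensional, so orthogonal projection onto it exists.
    -- This rules out the default value in `l2Proj`.
    let T : PolySpace k →ₗ[ℝ] Lp ℝ 2 (volume.restrict E) :=
      { toFun := fun p => (hmem p).toLp (polyFun p)
        map_add' := fun p q => by
          rw [← MemLp.toLp_add]
          congr 1
          ext x
          exact polyFun_add p q x
        map_smul' := fun c p => by
          rw [RingHom.id_apply, ← MemLp.toLp_const_smul]
          congr 1
          ext x
          exact polyFun_smul c p x }
    obtain ⟨p, hp⟩ := (LinearMap.range T).starProjection_apply_mem (hu.toLp u)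
    refine ⟨p, p.2, fun q hq => ?_⟩
    have horth := (LinearMap.range T).starProjection_inner_eq_zero (hu.toLp u) (T ⟨q, hq⟩)
      (LinearMap.mem_range_self _ _)
    rw [← hp, L2.inner_def] at horth
    rw [← neg_eq_zero, ← integral_neg, ← horth]
    refine integral_congr_ae ?_
    filter_upwards [(hmem p).coeFn_toLp, hu.coeFn_toLp, (hmem q).coeFn_toLp,
      Lp.coeFn_sub (hu.toLp u) (T p)] with x h1 h2 h3 h4
    have h5 : (T p) x = polyFun p x := h1
    have h6 : (T ⟨q, hq⟩) x = polyFun q x := h3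
    rw [h4, Pi.sub_apply, h2, h5, h6]
    simp only [RCLike.inner_apply, conj_trivial]
    ring
  unfold l2Proj
  rw [dif_pos hex]
  exact hex.choose_spec.2 q hq

/-- The `L²` projection is the best approximation. -/
theorem l2norm_sub_l2Proj_le {k : ℕ} [Module.Finite ℝ (PolySpace k)]
    (hmem : ∀ p, MemLp (polyFun p) 2 (volume.restrict E)) {u : Plane → ℝ}
    (hu : MemLp u 2 (volume.restrict E)) {q : MvPolynomial (Fin 2) ℝ} (hq : q ∈ PolySpace k) :
    l2norm E (fun x => u x - polyFun (l2Proj E k u) x) ≤ l2norm E (fun x => u x - polyFun q x) := by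
  set p := l2Proj E k u
  have h1 : MemLp (fun x => u x - polyFun p x) 2 (volume.restrict E) := hu.sub (hmem p)
  have h2 : MemLp (fun x => u x - polyFun q x) 2 (volume.restrict E) := hu.sub (hmem q)
  have h3 : MemLp (polyFun (p - q)) 2 (volume.restrict E) := hmem _
  have horth := integral_l2Proj_sub_mul_eq_zero hmem hu
    (Submodule.sub_mem _ (l2Proj_mem E k u) hq)
  have hi : Integrable (fun x => (polyFun p x - u x) * polyFun (p - q) x) (volume.restrict E) :=
    ((hmem p).sub hu).integrable_mul h3
  refine le_of_sq_le_sq ?_ (l2norm_nonneg _ _)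
  rw [sq_l2norm h1, sq_l2norm h2]
  -- Pythagoras: the cross term vanishes by orthogonality.
  have hexp : ∫ x in E, (u x - polyFun q x) ^ 2 =
      (∫ x in E, (u x - polyFun p x) ^ 2) + (∫ x in E, polyFun (p - q) x ^ 2) -
        2 * ∫ x in E, (polyFun p x - u x) * polyFun (p - q) x := by
    have hi' : Integrable (fun x => (u x - polyFun p x) ^ 2 + polyFun (p - q) x ^ 2)
      (volume.restrict E) := h1.integrable_sq.add h3.integrable_sq
    rw [← integral_const_mul, ← integral_add h1.integrable_sq h3.integrable_sq,
      ← integral_sub hi' (hi.const_mul 2)]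
    refine integral_congr_ae (Filter.Eventually.of_forall fun x => ?_)
    simp only [polyFun_sub]
    ring
  rw [hexp, horth]
  have : 0 ≤ ∫ x in E, polyFun (p - q) x ^ 2 := integral_nonneg fun _ => sq_nonneg _
  linarith

end

/-! ### The interpolation error -/

section

variable {N : ℕ} {P : Polygon Plane N} {k : ℕ}
  {m : Module.Basis (Fin (polyDim k)) ℝ (PolySpace k)}

namespace IsConvexPolygon

/-- The lower constant of a norm equivalence is controlled by the area of the element. -/
theorem mul_diam_le_sqrt_volume (hP : IsConvexPolygon P) {c₁ c₂ : ℝ}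
    (h : NormEquivalence P k m c₁ c₂) :
    c₁ * Metric.diam (element P) ≤ Real.sqrt (volume.real (element P)) := by
  have h1 := (h.2.2 _ (const_mem_serendipitySpace 1)).1
  have hone : l2norm (element P) (fun _ => 1) = Real.sqrt (volume.real (element P)) := by
    rw [← Real.sqrt_sq (l2norm_nonneg _ _), sq_l2norm (memLp_element continuousOn_const)]
    simp
  -- A single vertex value already contributes `1`.
  have hchi : 1 ≤ chiNorm P k m (fun _ => 1) := by
    rw [chiNorm, Real.one_le_sqrt]
    have i₀ : Fin N := ⟨0, by have := hP.two_le; omega⟩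
    refine le_trans (by simp [chi]) (Finset.single_le_sum
      (f := fun i => chi P k m (fun _ => 1) i ^ 2) (fun i _ => sq_nonneg _)
      (Finset.mem_univ (Sum.inl (i₀, ⟨0, Finset.mem_insert_self _ _⟩))))
  rw [hone] at h1
  refine le_trans ?_ h1
  exact le_mul_of_one_le_right (mul_nonneg h.1.le Metric.diam_nonneg) hchi

/-- Cauchy–Schwarz contributes `√|E|` against the factor `|E|⁻¹` of the moment, which leaves `1 /
√|E|`. -/
theorem abs_moment_sub_le (hP : IsConvexPolygon P) {f : ℝ → ℝ} {L : ℝ}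
    (hf : ∀ x y : ℝ, |f x - f y| ≤ L * |x - y|) {g h : Plane → ℝ}
    (hg : ContinuousOn g (closure (element P))) (hh : ContinuousOn h (closure (element P)))
    {q : MvPolynomial (Fin 2) ℝ}
    (hq : eLpNorm (polyFun q) ⊤ (volume.restrict (element P)) ≤ 1) :
    |moment (element P) q (fun x => f (g x)) - moment (element P) q (fun x => f (h x))| ≤
      L * l2norm (element P) (fun x => g x - h x) / Real.sqrt (volume.real (element P)) := by
  have hA := hP.volume_element_pos
  set A := volume.real (element P)
  have hL : 0 ≤ L := by simpa using (abs_nonneg _).trans (hf 1 0)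
  have hfc : Continuous f := (LipschitzWith.of_dist_le_mul (K := ⟨L, hL⟩) hf).continuous
  have hqc := (continuous_polyFun q).continuousOn (s := closure (element P))
  have hi1 : IntegrableOn (fun x => f (g x) * polyFun q x) (element P) :=
    integrableOn_element ((hfc.comp_continuousOn hg).mul hqc)
  have hi2 : IntegrableOn (fun x => f (h x) * polyFun q x) (element P) :=
    integrableOn_element ((hfc.comp_continuousOn hh).mul hqc)
  have hi3 : IntegrableOn (fun x => L * |g x - h x|) (element P) :=
    integrableOn_element (continuousOn_const.mul (hg.sub hh).abs)
  have hq1 : ∀ᵐ x ∂volume.restrict (element P), |polyFun q x| ≤ 1 := by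
    rw [eLpNorm_exponent_top] at hq
    filter_upwards [ae_le_eLpNormEssSup (f := polyFun q) (μ := volume.restrict (element P))]
      with x hx
    have := hx.trans hq
    rwa [Real.enorm_eq_ofReal_abs, ENNReal.ofReal_le_one] at this
  have hbound : |∫ x in element P, (f (g x) * polyFun q x - f (h x) * polyFun q x)| ≤
      ∫ x in element P, L * |g x - h x| := by
    rw [← Real.norm_eq_abs]
    refine norm_integral_le_of_norm_le hi3 ?_
    filter_upwards [hq1] with x hx
    rw [← sub_mul, norm_mul, Real.norm_eq_abs, Real.norm_eq_abs]
    calc |f (g x) - f (h x)| * |polyFun q x| ≤ |f (g x) - f (h x)| * 1 :=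
          mul_le_mul_of_nonneg_left hx (abs_nonneg _)
      _ ≤ L * |g x - h x| := by rw [mul_one]; exact hf _ _
  have hCS := integral_abs_le_sqrt_mul_l2norm volume_element_ne_top hA
    (memLp_element (hg.sub hh))
  rw [integral_const_mul] at hbound
  have hs : 0 < Real.sqrt A := Real.sqrt_pos.2 hA
  rw [moment, moment, ← mul_sub, ← integral_sub hi1 hi2, abs_mul, abs_of_pos (inv_pos.2 hA),
    inv_mul_le_iff₀ hA]
  refine hbound.trans ((mul_le_mul_of_nonneg_left hCS hL).trans (le_of_eq ?_))
  have hss : Real.sqrt A * Real.sqrt A = A := Real.mul_self_sqrt hA.le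
  change L * (Real.sqrt A * l2norm (element P) (fun x => g x - h x)) = _
  rw [← mul_div_assoc, eq_div_iff hs.ne']
  linear_combination (L * l2norm (element P) (fun x => g x - h x)) * hss

end IsConvexPolygon

/-- A bound of the degrees of freedom of a function with vanishing boundary values. -/
theorem chiNorm_le_of_bound {v : Plane → ℝ} {M : ℝ} (hM : 0 ≤ M)
    (hbdry : ∀ i, chi P k m v (Sum.inl i) = 0) (hmom : ∀ α, |chi P k m v (Sum.inr α)| ≤ M) :
    chiNorm P k m v ≤ polyDim (k - eta P) * M := by
  refine Real.sqrt_le_iff.2 ⟨by positivity, ?_⟩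
  rw [Fintype.sum_sum_type]
  simp only [hbdry]
  have h1 : ∑ α, chi P k m v (Sum.inr α) ^ 2 ≤ ∑ _α : MomIndex P k, M ^ 2 :=
    Finset.sum_le_sum fun α _ => sq_le_sq' (abs_le.1 (hmom α)).1 (abs_le.1 (hmom α)).2
  rw [Finset.sum_const, Finset.card_univ, card_momIndex m, nsmul_eq_mul] at h1
  -- The sum of squares gives the factor `√r`; it is weakened to `r` by `r ≤ r²` for natural
  -- numbers.
  have h2 : (polyDim (k - eta P) : ℝ) ≤ (polyDim (k - eta P) : ℝ) ^ 2 := by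
    exact_mod_cast Nat.le_self_pow two_ne_zero _
  have h3 := mul_le_mul_of_nonneg_right h2 (sq_nonneg M)
  rw [mul_pow]
  simpa using h1.trans h3

/-- The estimate in terms of `u_h` alone. The element size cancels because the `1 / √|E|` from the
moments meets the diameter from the norm equivalence. -/
theorem IsConvexPolygon.l2norm_interpolant_sub_quasiInterpolant_le (hP : IsConvexPolygon P)
    (hbound : ∀ α : Fin (polyDim k), (α : ℕ) < polyDim (k - eta P) →
      eLpNorm (polyFun (m α)) ⊤ (volume.restrict (element P)) ≤ 1)
    {c₁ c₂ : ℝ} (hc : NormEquivalence P k m c₁ c₂) {f : ℝ → ℝ} {L : ℝ}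
    (hf : ∀ x y : ℝ, |f x - f y| ≤ L * |x - y|) {uh w wt : Plane → ℝ}
    (huh : uh ∈ serendipitySpace P k m) (hw : IsInterpolant P k m (fun x => f (uh x)) w)
    (hwt : IsQuasiInterpolant P k m f uh wt) :
    l2norm (element P) (fun x => w x - wt x) ≤ c₂ * L * polyDim (k - eta P) / c₁ *
      l2norm (element P) (fun x => uh x - polyFun (l2Proj (element P) k uh) x) := by
  obtain ⟨hc₁, hc₂, hequiv⟩ := id hc
  have hL : 0 ≤ L := by simpa using (abs_nonneg _).trans (hf 1 0)
  set D := l2norm (element P) (fun x => uh x - polyFun (l2Proj (element P) k uh) x)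
  have hD : 0 ≤ D := l2norm_nonneg _ _
  have hs : 0 < Real.sqrt (volume.real (element P)) := Real.sqrt_pos.2 hP.volume_element_pos
  set s := Real.sqrt (volume.real (element P))
  have hmem : w - wt ∈ serendipitySpace P k m :=
    Submodule.sub_mem (serendipitySubmodule P k m) hw.1 hwt.1
  have hchi : ∀ i, chi P k m (w - wt) i = chi P k m w i - chi P k m wt i := by
    intro i
    have h1 := chi_add (m := m) (P := P) (continuousOn_of_mem_serendipitySpace hmem)
      (continuousOn_of_mem_serendipitySpace hwt.1)
    rw [sub_add_cancel] at h1
    rw [h1, Pi.add_apply, add_sub_cancel_right]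
  have hnorm : chiNorm P k m (w - wt) ≤ polyDim (k - eta P) * (L * D / s) := by
    refine chiNorm_le_of_bound (by positivity) (fun i => ?_) fun α => ?_
    · rw [hchi, hwt.2.1 i, hw.2]
      exact sub_self _
    · rw [hchi, hwt.2.2 α, hw.2]
      exact hP.abs_moment_sub_le hf (continuousOn_of_mem_serendipitySpace huh)
        (continuous_polyFun _).continuousOn (hbound α α.2)
  have hdiam : Metric.diam (element P) / s ≤ 1 / c₁ := by
    rw [div_le_div_iff₀ hs hc₁]
    linarith [hP.mul_diam_le_sqrt_volume hc]
  calc l2norm (element P) (fun x => w x - wt x)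
      ≤ c₂ * Metric.diam (element P) * chiNorm P k m (w - wt) := (hequiv _ hmem).2
    _ ≤ c₂ * Metric.diam (element P) * (polyDim (k - eta P) * (L * D / s)) :=
        mul_le_mul_of_nonneg_left hnorm (mul_nonneg hc₂.le Metric.diam_nonneg)
    _ = c₂ * L * polyDim (k - eta P) * D * (Metric.diam (element P) / s) := by ring
    _ ≤ c₂ * L * polyDim (k - eta P) * D * (1 / c₁) :=
        mul_le_mul_of_nonneg_left hdiam (by positivity)
    _ = c₂ * L * polyDim (k - eta P) / c₁ * D := by ring

end

end SVEM

end


/-! ### Conclusion: existence of the constants and the error bound. -/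

theorem lemma6 {N : ℕ} (P : Polygon SVEM.Plane N) (hP : SVEM.IsConvexPolygon P)
    (k : ℕ) (hk : SVEM.eta P ≤ k)
    -- a basis of `P_k` whose first `r_{k - η}` elements form a basis of `P_{k - η}` ...
    (m : Module.Basis (Fin (SVEM.polyDim k)) ℝ (SVEM.PolySpace k))
    (hm : ∀ α : Fin (SVEM.polyDim k), (α : ℕ) < SVEM.polyDim (k - SVEM.eta P) →
      (m α : MvPolynomial (Fin 2) ℝ) ∈ SVEM.PolySpace (k - SVEM.eta P))
    -- ... bounded by `1` in the `L^∞(E)` norm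
    (hbound : ∀ α : Fin (SVEM.polyDim k), (α : ℕ) < SVEM.polyDim (k - SVEM.eta P) →
      MeasureTheory.eLpNorm (SVEM.polyFun (m α)) ⊤
        (MeasureTheory.volume.restrict (SVEM.element P)) ≤ 1) :
    (∃ c₁ c₂ : ℝ, SVEM.NormEquivalence P k m c₁ c₂) ∧
    ∀ c₁ c₂ : ℝ, SVEM.NormEquivalence P k m c₁ c₂ →
    ∀ (f : ℝ → ℝ) (L : ℝ), (∀ x y : ℝ, |f x - f y| ≤ L * |x - y|) →
    ∀ u : SVEM.Plane → ℝ,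
      MeasureTheory.MemLp u 2 (MeasureTheory.volume.restrict (SVEM.element P)) →
    ∀ uh ∈ SVEM.serendipitySpace P k m,
    ∀ w : SVEM.Plane → ℝ, SVEM.IsInterpolant P k m (fun x => f (uh x)) w →
    ∀ wt : SVEM.Plane → ℝ, SVEM.IsQuasiInterpolant P k m f uh wt →
      SVEM.l2norm (SVEM.element P) (fun x => w x - wt x) ≤
        c₂ * L * (SVEM.polyDim (k - SVEM.eta P) : ℝ) / c₁ *
          (2 * SVEM.l2norm (SVEM.element P) (fun x => u x - uh x) +
            SVEM.l2norm (SVEM.element P)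
              (fun x => u x - SVEM.polyFun (SVEM.l2Proj (SVEM.element P) k u) x)) := by
  refine ⟨hP.exists_normEquivalence hk hm, ?_⟩
  intro c₁ c₂ hc f L hf u hu uh huh w hw wt hwt
  have : Module.Finite ℝ (SVEM.PolySpace k) := Module.Finite.of_basis m
  have hL : 0 ≤ L := by simpa using (abs_nonneg _).trans (hf 1 0)
  have huhc := SVEM.memLp_element (SVEM.continuousOn_of_mem_serendipitySpace huh)
  refine (hP.l2norm_interpolant_sub_quasiInterpolant_le hbound hc hf huh hw hwt).trans ?_
  refine mul_le_mul_of_nonneg_left ?_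
    (div_nonneg (mul_nonneg (mul_nonneg hc.2.1.le hL) (Nat.cast_nonneg _)) hc.1.le)
  -- Best approximation replaces `Π⁰u_h` by `Π⁰u`. The triangle inequality then needs `‖e_u‖` only
  -- once, so the factor `2` has slack.
  refine (SVEM.l2norm_sub_l2Proj_le SVEM.memLp_polyFun huhc
    (SVEM.l2Proj_mem (SVEM.element P) k u)).trans ?_
  have htri := SVEM.l2norm_sub_le
    (hu.sub (SVEM.memLp_polyFun (SVEM.l2Proj (SVEM.element P) k u))) (hu.sub huhc)
  simp only [Pi.sub_apply, sub_sub_sub_cancel_left] at htri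
  have h0 := SVEM.l2norm_nonneg (SVEM.element P) (fun x => u x - uh x)
  have h1 : SVEM.l2norm (SVEM.element P) (u - uh) =
    SVEM.l2norm (SVEM.element P) (fun x => u x - uh x) := rfl
  have h2 : SVEM.l2norm (SVEM.element P)
      (u - SVEM.polyFun (SVEM.l2Proj (SVEM.element P) k u)) =
    SVEM.l2norm (SVEM.element P)
      (fun x => u x - SVEM.polyFun (SVEM.l2Proj (SVEM.element P) k u) x) := rfl
  linarith
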